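/- Let $h_1,h_2,\dots$ be algebraically independent variables over $\mathbb R$, $h_0=1$ and $h_n=0$ for $n<0$; polynomials in the $h_i$ are called symmetric functions. A partition $\lambda=(\lambda_1\ge\dots\ge\lambda_m>0)$ has size $|\lambda|=\sum_i\lambda_i$ and $m$ parts, and its Schur function is $s_\lambda=\det(h_{\lambda_i-i+j})_{1\le i,j\le m}$. The $s_\lambda$ form a basis of the space of symmetric functions; let $\langle\cdot,\cdot\rangle$ be the inner product for which they are orthonormal. Write $\mu\trianglerighteq\nu$ (dominance) if $|\mu|=|\nu|$ and $\mu_1+\dots+\mu_i\ge\nu_1+\dots+\nu_i$ for all $i$, and put $[\lambda,\rho]=\{\mu:\rho\trianglerighteq\mu\trianglerighteq\lambda\}$. Let $\mathcal{SP}_N$ be the set of finite multisets $A$ of partitions with one or two parts such that $\sum_{\mu\in A}|\mu|=N$. For $A\in\mathcal{SP}_N$ let $s_A=\prod_{\mu\in A}s_\mu$, and let $\phi(A)$ be the partition of $N$ whose parts are all the parts of the members of $A$. Call $A$ nested if no pair of members $\{\lambda,\mu\}$ of $A$ (counted with multiplicity, in either order) satisfies one of the following: 1. $\lambda=(\lambda_1\ge\lambda_2>0)$,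 $\mu=(\mu_1\ge\mu_2>0)$ and $\lambda_1>\mu_1\ge\lambda_2>\mu_2$; 2. $\lambda=(\lambda_1>\lambda_2>0)$, $\mu=(\mu_1>0)$ and $\lambda_1\ge\mu_1\ge\lambda_2$; 3. $\lambda=(\lambda_1>0)$ and $\mu=(\mu_1>0)$. The cone of log concavity $\mathcal C_N^2$ is the set of linear combinations with nonnegative coefficients of the $s_B$, $B\in\mathcal{SP}_N$. Call $A\in\mathcal{SP}_N$ extreme in $\mathcal C_N^2$ if $s_A$ is not a linear combination with nonnegative coefficients of the $s_B$ with $B\in\mathcal{SP}_N$, $B\ne A$. **Theorem.** Let $\lambda=(\lambda_1>\lambda_2>\dots>\lambda_m>0)$ be a partition of $N$ with distinct parts, let $A\in\mathcal{SP}_N$ be nested with $\phi(A)=\lambda$, and let $\lambda^+=(\lambda_1+1,\lambda_2,\dots,\lambda_{m-1},\lambda_m-1)$ (a last part $0$ is omitted; $\lambda^+=\lambda$ if $m\le 1$). Then there is a symmetric function $f$, with integer coefficients in the basis of Schur functions, that separates $A$ on $[\lambda,\lambda^+]$, that is: - $\langle f,s_\mu\rangle=0$ for every partition $\mu\notin[\lambda,\lambda^+]$;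 - $\langle f,s_A\rangle>0$; - $\langle f,s_B\rangle\le0$ for every $B\in\mathcal{SP}_N$ (nested or not) with $\phi(B)\in[\lambda,\lambda^+]$ and $B\ne A$. Moreover, $A$ is extreme in $\mathcal C_N^2$. -/

import Mathlib

namespace SchurCone

/-- A partition (of any size): a finite multiset of positive integers, its parts. -/
abbrev Ptn := Multiset ℕ+

/-- The number `|lam|` that `lam` is a partition of: the sum of the parts. -/
def size (lam : Ptn) : ℕ := (lam.map (fun k : ℕ+ => (k : ℕ))).sum

/-- The parts of `lam` in weakly decreasing order, indexed from `0`
(so `part lam 0` is the largest part), and `0` beyond the number of parts. -/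
def part (lam : Ptn) (i : ℕ) : ℕ :=
  ((lam.sort (fun a b => b ≤ a)).map (fun k : ℕ+ => (k : ℕ))).getD i 0

/-- The partition whose parts are the nonzero numbers among `a 0, …, a (n - 1)`. -/
def ofSeq (n : ℕ) (a : ℕ → ℕ) : Ptn :=
  (Multiset.range n).filterMap
    (fun i => if h : 0 < a i then some (⟨a i, h⟩ : ℕ+) else none)

/-- Dominance order: `Dominates lam mu` says that `lam` dominates `mu`
(two partitions of the same number). -/
def Dominates (lam mu : Ptn) : Prop :=
  size lam = size mu ∧
    ∀ n : ℕ, ∑ i ∈ Finset.range n, part mu i ≤ ∑ i ∈ Finset.range n, part lam i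

/-- The interval `[lam, rho]` in dominance order. -/
def domInterval (lam rho : Ptn) : Set Ptn :=
  {mu | Dominates mu lam ∧ Dominates rho mu}

/-- The partition `(lam_1 + 1, lam_2, …, lam_{m-1}, lam_m - 1)`, where `m` is the number
of parts of `lam`. (For `m = 1` the two changes cancel.) -/
def plus (lam : Ptn) : Ptn :=
  ofSeq (Multiset.card lam) (fun i =>
    part lam i + (if i = 0 then 1 else 0) - (if i + 1 = Multiset.card lam then 1 else 0))

/-- The ring of symmetric functions with real coefficients, as the polynomial ring in the
algebraically independent variables `h_1, h_2, …` (the complete homogeneous ones). -/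
abbrev SymFun := MvPolynomial ℕ+ ℝ

/-- `h_n` for an arbitrary integer `n`, with `h_0 = 1` and `h_n = 0` for `n < 0`. -/
noncomputable def hFun (n : ℤ) : SymFun :=
  if hn : 0 < n then MvPolynomial.X ⟨n.toNat, by omega⟩ else if n = 0 then 1 else 0

/-- The Schur function `s_lam = det (h_{lam_i - i + j})` (Jacobi-Trudi). -/
noncomputable def schur (lam : Ptn) : SymFun :=
  Matrix.det (Matrix.of fun i j : Fin (Multiset.card lam) =>
    hFun ((part lam i : ℤ) - (i : ℤ) + (j : ℤ)))

/-! ### The Schur functions form a basis -/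

/-- The sum of the squares of the parts. -/
def sqSize (lam : Ptn) : ℕ := (lam.map (fun k : ℕ+ => (k : ℕ) ^ 2)).sum

/-- The monomial `h_lam`. -/
noncomputable def hMon (lam : Ptn) : SymFun := MvPolynomial.monomial (Multiset.toFinsupp lam) 1

theorem hMon_cons (k : ℕ+) (lam : Ptn) : hMon (k ::ₘ lam) = MvPolynomial.X k * hMon lam := by
  unfold hMon
  rw [MvPolynomial.X, MvPolynomial.monomial_mul, ← Multiset.singleton_add, map_add,
    Multiset.toFinsupp_singleton, one_mul]

theorem hMon_eq (lam : Ptn) : hMon lam = (lam.map MvPolynomial.X).prod := by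
  induction lam using Multiset.induction_on with
  | empty => simp [hMon]
  | cons k lam ih => rw [hMon_cons, ih, Multiset.map_cons, Multiset.prod_cons]

theorem h_coe (k : ℕ+) : hFun ((k : ℕ) : ℤ) = MvPolynomial.X k := by
  have : (0 : ℤ) < ((k : ℕ) : ℤ) := by exact_mod_cast k.pos
  rw [hFun, dif_pos this]
  congr 1

theorem prod_h {ι : Type} (s : Finset ι) (a : ι → ℤ) :
    ∏ i ∈ s, hFun (a i) = 0 ∨ ∃ nu : Ptn, ∏ i ∈ s, hFun (a i) = hMon nu ∧
      (size nu : ℤ) = ∑ i ∈ s, a i ∧ (sqSize nu : ℤ) = ∑ i ∈ s, a i ^ 2 := by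
  classical
  induction s using Finset.induction_on with
  | empty => exact Or.inr ⟨0, by simp [hMon], by simp [size], by simp [sqSize]⟩
  | insert i s hi ih =>
    rw [Finset.prod_insert hi, Finset.sum_insert hi, Finset.sum_insert hi]
    rcases ih with h0 | ⟨nu, h1, h2, h3⟩
    · left; rw [h0, mul_zero]
    · rcases lt_trichotomy (a i) 0 with hn | hz | hp
      · left
        rw [hFun, dif_neg (by omega), if_neg (by omega), zero_mul]
      · right
        refine ⟨nu, ?_, ?_, ?_⟩
        · rw [hz, h1]; simp [hFun]
        · rw [hz, h2, zero_add]
        · rw [hz, h3]; simp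
      · right
        obtain ⟨k, hk⟩ : ∃ k : ℕ+, a i = ((k : ℕ) : ℤ) :=
          ⟨⟨(a i).toNat, by omega⟩, by simp [hp.le]⟩
        refine ⟨k ::ₘ nu, ?_, ?_, ?_⟩
        · rw [hk, h_coe, h1, hMon_cons]
        · rw [hk, ← h2]; simp [size]
        · rw [hk, ← h3]; simp [sqSize]

theorem prod_h_part (lam : Ptn) :
    ∏ i : Fin (Multiset.card lam), hFun (part lam i : ℤ) = hMon lam := by
  have hl : (lam.sort (fun a b => b ≤ a)).length = Multiset.card lam := by simp
  rw [hMon_eq]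
  conv_rhs => rw [← Multiset.sort_eq lam (fun a b => b ≤ a)]
  rw [Multiset.map_coe, Multiset.prod_coe, ← Fin.prod_univ_getElem]
  refine Fintype.prod_equiv (finCongr (by simp)) _ _ fun i => ?_
  have hi : (i : ℕ) < (lam.sort (fun a b => b ≤ a)).length := by rw [hl]; exact i.2
  simp [part, h_coe]

theorem part_anti (lam : Ptn) {i j : ℕ} (hij : i ≤ j) : part lam j ≤ part lam i := by
  unfold part
  have hs : ((lam.sort (fun a b => b ≤ a)).map (fun k : ℕ+ => (k : ℕ))).Pairwise
      (fun a b => b ≤ a) := by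
    rw [List.pairwise_map]
    exact (Multiset.pairwise_sort lam (fun a b => b ≤ a)).imp (fun hab => hab)
  generalize (lam.sort (fun a b => b ≤ a)).map (fun k : ℕ+ => (k : ℕ)) = l at hs
  rcases hij.eq_or_lt with rfl | hlt
  · exact le_rfl
  · by_cases hj : j < l.length
    · rw [List.getD_eq_getElem _ _ hj, List.getD_eq_getElem _ _ (hlt.trans hj)]
      exact List.pairwise_iff_getElem.mp hs i j (hlt.trans hj) hj hlt
    · rw [List.getD_eq_default _ _ (by omega)]; exact Nat.zero_le _

theorem hMon_injective : Function.Injective hMon := by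
  intro a b hab
  have := MvPolynomial.monomial_left_injective (one_ne_zero (α := ℝ)) hab
  exact Multiset.toFinsupp.injective this

theorem coeff_hMon (lam nu : Ptn) :
    MvPolynomial.coeff (Multiset.toFinsupp nu) (hMon lam) = if lam = nu then 1 else 0 := by
  classical
  rw [hMon, MvPolynomial.coeff_monomial]
  simp

theorem part_sums (lam : Ptn) :
    (size lam : ℤ) = ∑ i : Fin (Multiset.card lam), (part lam i : ℤ) ∧
      (sqSize lam : ℤ) = ∑ i : Fin (Multiset.card lam), (part lam i : ℤ) ^ 2 := by
  rcases prod_h Finset.univ (fun i : Fin (Multiset.card lam) => (part lam i : ℤ)) with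
    h0 | ⟨nu, h1, h2, h3⟩
  · rw [prod_h_part, hMon, MvPolynomial.monomial_eq_zero] at h0
    exact absurd h0 one_ne_zero
  · rw [prod_h_part] at h1
    obtain rfl := hMon_injective h1
    exact ⟨h2, h3⟩

/-- Each term of the Jacobi-Trudi determinant off the diagonal is `0` or a monomial whose
partition has the same size and a larger sum of squares. -/
theorem term_off_diagonal (lam : Ptn) (σ : Equiv.Perm (Fin (Multiset.card lam))) (hσ : σ ≠ 1) :
    ∏ i, hFun ((part lam (σ i) : ℤ) - ((σ i : ℕ) : ℤ) + ((i : ℕ) : ℤ)) = 0 ∨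
      ∃ nu : Ptn, ∏ i, hFun ((part lam (σ i) : ℤ) - ((σ i : ℕ) : ℤ) + ((i : ℕ) : ℤ)) = hMon nu ∧
        size nu = size lam ∧ sqSize lam < sqSize nu := by
  refine (prod_h Finset.univ _).imp_right ?_
  rintro ⟨nu, h1, h2, h3⟩
  refine ⟨nu, h1, ?_, ?_⟩
  · have e1 := Equiv.sum_comp σ (fun i => (part lam i : ℤ))
    have e2 := Equiv.sum_comp σ (fun i => ((i : ℕ) : ℤ))
    rw [Finset.sum_add_distrib, Finset.sum_sub_distrib, e1, e2, ← (part_sums lam).1] at h2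
    have : (size nu : ℤ) = size lam := by rw [h2]; ring
    exact_mod_cast this
  · set a : Fin (Multiset.card lam) → ℤ := fun i => (part lam i : ℤ) - ((i : ℕ) : ℤ) with ha
    set g : Fin (Multiset.card lam) → ℤ := fun i => ((i : ℕ) : ℤ) with hg
    have hanti : StrictAnti a := by
      intro i j hij
      have h1 : (part lam j : ℤ) ≤ part lam i := by exact_mod_cast part_anti lam hij.le
      have h2 : ((i : ℕ) : ℤ) < ((j : ℕ) : ℤ) := by exact_mod_cast hij
      simp only [ha]; linarith
    have hgm : StrictMono g := by
      intro i j hij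
      simp only [hg]; exact_mod_cast hij
    have hav : Antivary a g := fun i j hij => (hanti (hgm.lt_iff_lt.mp hij)).le
    have hlt : ∑ i, a i * g i < ∑ i, a (σ i) * g i := by
      rw [hav.sum_mul_lt_sum_comp_perm_mul_iff]
      intro hc
      apply hσ
      have hm : Monotone σ := by
        intro i j hij
        rcases hij.eq_or_lt with rfl | hlt
        · exact le_rfl
        · exact hanti.le_iff_ge.mp (hc (hgm hlt))
      have hsm : StrictMono σ := hm.strictMono_of_injective σ.injective
      ext i
      have := congrArg (fun f : Fin (Multiset.card lam) → Fin (Multiset.card lam) => (f i : ℕ))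
        ((hsm.range_inj strictMono_id).mp (by simp))
      simpa using this
    have e1 := Equiv.sum_comp σ (fun i => a i ^ 2)
    have x1 : ∑ i, ((part lam (σ i) : ℤ) - ((σ i : ℕ) : ℤ) + ((i : ℕ) : ℤ)) ^ 2
        = ∑ i, a i ^ 2 + 2 * ∑ i, a (σ i) * g i + ∑ i, g i ^ 2 := by
      rw [← e1, Finset.mul_sum, ← Finset.sum_add_distrib, ← Finset.sum_add_distrib]
      refine Finset.sum_congr rfl fun i _ => ?_
      simp only [ha, hg]; ring
    have x2 : ∑ i : Fin (Multiset.card lam), (part lam i : ℤ) ^ 2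
        = ∑ i, a i ^ 2 + 2 * ∑ i, a i * g i + ∑ i, g i ^ 2 := by
      rw [Finset.mul_sum, ← Finset.sum_add_distrib, ← Finset.sum_add_distrib]
      refine Finset.sum_congr rfl fun i _ => ?_
      simp only [ha, hg]; ring
    have : (sqSize lam : ℤ) < sqSize nu := by
      rw [h3, (part_sums lam).2, x1, x2]; linarith
    exact_mod_cast this

theorem coeff_schur_eq (lam nu : Ptn) :
    MvPolynomial.coeff (Multiset.toFinsupp nu) (schur lam) =
      ∑ σ : Equiv.Perm (Fin (Multiset.card lam)), ((Equiv.Perm.sign σ : ℤ) : ℝ) *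
        MvPolynomial.coeff (Multiset.toFinsupp nu)
          (∏ i, hFun ((part lam (σ i) : ℤ) - ((σ i : ℕ) : ℤ) + ((i : ℕ) : ℤ))) := by
  rw [schur, Matrix.det_apply, MvPolynomial.coeff_sum]
  refine Finset.sum_congr rfl fun σ _ => ?_
  simp only [Matrix.of_apply]
  rw [Units.smul_def, ← Int.cast_smul_eq_zsmul ℝ, MvPolynomial.coeff_smul, smul_eq_mul]

theorem term_diagonal (lam : Ptn) :
    ∏ i : Fin (Multiset.card lam), hFun (
      (part lam ((1 : Equiv.Perm (Fin (Multiset.card lam))) i) : ℤ)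
      - (((1 : Equiv.Perm (Fin (Multiset.card lam))) i : ℕ) : ℤ) + ((i : ℕ) : ℤ)) = hMon lam := by
  rw [← prod_h_part]
  refine Finset.prod_congr rfl fun i _ => ?_
  simp

theorem coeff_schur_self (lam : Ptn) :
    MvPolynomial.coeff (Multiset.toFinsupp lam) (schur lam) = 1 := by
  rw [coeff_schur_eq, Finset.sum_eq_single 1]
  · rw [term_diagonal, coeff_hMon]; simp
  · intro σ _ hσ
    rcases term_off_diagonal lam σ hσ with h0 | ⟨nu, h1, _, h3⟩
    · rw [h0]; simp
    · rw [h1, coeff_hMon, if_neg (by rintro rfl; exact lt_irrefl _ h3), mul_zero]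
  · simp

theorem coeff_schur_ne_zero (lam nu : Ptn)
    (hne : MvPolynomial.coeff (Multiset.toFinsupp nu) (schur lam) ≠ 0) :
    nu = lam ∨ (size nu = size lam ∧ sqSize lam < sqSize nu) := by
  rw [coeff_schur_eq] at hne
  obtain ⟨σ, _, hσ⟩ := Finset.exists_ne_zero_of_sum_ne_zero hne
  by_cases h1 : σ = 1
  · left
    subst h1
    rw [term_diagonal, coeff_hMon] at hσ
    by_contra hc
    rw [if_neg (fun h => hc h.symm), mul_zero] at hσ
    exact hσ rfl
  · right
    rcases term_off_diagonal lam σ h1 with h0 | ⟨mu, h1, h2, h3⟩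
    · rw [h0] at hσ; simp at hσ
    · rw [h1, coeff_hMon] at hσ
      have : mu = nu := by
        by_contra hc
        rw [if_neg hc, mul_zero] at hσ
        exact hσ rfl
      subst this
      exact ⟨h2, h3⟩

theorem sqSize_le (lam : Ptn) : sqSize lam ≤ size lam ^ 2 := by
  induction lam using Multiset.induction_on with
  | empty => simp [sqSize, size]
  | cons k lam ih =>
    simp only [sqSize, size, Multiset.map_cons, Multiset.sum_cons] at ih ⊢
    nlinarith [Nat.zero_le ((k : ℕ) * (lam.map (fun k : ℕ+ => (k : ℕ))).sum)]

theorem schur_linearIndependent : LinearIndependent ℝ schur := by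
  classical
  rw [linearIndependent_iff']
  intro s c hc
  by_contra hcon
  push Not at hcon
  obtain ⟨i0, hi0, hci0⟩ := hcon
  obtain ⟨lam, hlam, hmin⟩ := Finset.exists_min_image (s.filter fun i => c i ≠ 0) sqSize
    ⟨i0, by simp [hi0, hci0]⟩
  rw [Finset.mem_filter] at hlam
  have hz := congrArg (MvPolynomial.coeff (Multiset.toFinsupp lam)) hc
  rw [MvPolynomial.coeff_sum, MvPolynomial.coeff_zero, Finset.sum_eq_single lam] at hz
  · rw [MvPolynomial.coeff_smul, coeff_schur_self, smul_eq_mul, mul_one] at hz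
    exact hlam.2 hz
  · intro mu hmu hne
    rw [MvPolynomial.coeff_smul, smul_eq_mul]
    by_contra hprod
    have h1 := left_ne_zero_of_mul hprod
    have h2 := right_ne_zero_of_mul hprod
    rcases coeff_schur_ne_zero mu lam h2 with h | ⟨_, h⟩
    · exact hne h.symm
    · exact absurd (hmin mu (by simp [hmu, h1])) (by omega)
  · exact fun hn => absurd hlam.1 hn

theorem hMon_mem_span (n : ℕ) : ∀ lam : Ptn, size lam ^ 2 - sqSize lam = n →
    hMon lam ∈ Submodule.span ℝ (Set.range schur) := by
  classical
  induction n using Nat.strong_induction_on with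
  | _ n ih =>
    intro lam hn
    have hsum := MvPolynomial.as_sum (schur lam)
    have hmem : Multiset.toFinsupp lam ∈ (schur lam).support := by
      rw [MvPolynomial.mem_support_iff, coeff_schur_self]; exact one_ne_zero
    rw [← Finset.add_sum_erase _ _ hmem, coeff_schur_self] at hsum
    have heq : hMon lam = schur lam - ∑ d ∈ (schur lam).support.erase (Multiset.toFinsupp lam),
        MvPolynomial.monomial d (MvPolynomial.coeff d (schur lam)) := by
      rw [eq_sub_iff_add_eq]; exact hsum.symm
    rw [heq]
    refine Submodule.sub_mem _ (Submodule.subset_span ⟨lam, rfl⟩) (Submodule.sum_mem _ ?_)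
    intro d hd
    rw [Finset.mem_erase, MvPolynomial.mem_support_iff] at hd
    obtain ⟨nu, rfl⟩ := Multiset.toFinsupp.surjective d
    have hmon : MvPolynomial.monomial (Multiset.toFinsupp nu)
        (MvPolynomial.coeff (Multiset.toFinsupp nu) (schur lam)) =
        MvPolynomial.coeff (Multiset.toFinsupp nu) (schur lam) • hMon nu := by
      rw [hMon, MvPolynomial.smul_monomial, smul_eq_mul, mul_one]
    rw [hmon]
    refine Submodule.smul_mem _ _ ?_
    rcases coeff_schur_ne_zero lam nu hd.2 with h | ⟨h1, h2⟩
    · exact absurd (by rw [h]) hd.1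
    · refine ih _ ?_ nu rfl
      have := sqSize_le nu
      rw [h1] at this ⊢
      omega

theorem schur_span : ⊤ ≤ Submodule.span ℝ (Set.range schur) := by
  intro p _
  rw [MvPolynomial.as_sum p]
  refine Submodule.sum_mem _ fun d _ => ?_
  obtain ⟨nu, rfl⟩ := Multiset.toFinsupp.surjective d
  have hmon : MvPolynomial.monomial (Multiset.toFinsupp nu)
      (MvPolynomial.coeff (Multiset.toFinsupp nu) p) =
      MvPolynomial.coeff (Multiset.toFinsupp nu) p • hMon nu := by
    rw [hMon, MvPolynomial.smul_monomial, smul_eq_mul, mul_one]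
  rw [hmon]
  exact Submodule.smul_mem _ _ (hMon_mem_span _ nu rfl)

/-- The basis of the symmetric functions formed by the Schur functions. -/
noncomputable def schurBasis : Module.Basis Ptn ℝ SymFun :=
  Module.Basis.mk schur_linearIndependent schur_span

/-- The standard inner product of symmetric functions, for which the Schur functions are
orthonormal: `⟨f, g⟩ = ∑ f_mu g_mu`, where `f_mu`, `g_mu` are the coefficients in the
basis of Schur functions. -/
noncomputable def hallInner (f g : SymFun) : ℝ :=
  (schurBasis.repr f).sum fun mu c => c * schurBasis.repr g mu

theorem hallInner_schur (lam mu : Ptn) :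
    hallInner (schur lam) (schur mu) = if lam = mu then 1 else 0 := by
  classical
  have h (nu : Ptn) : schurBasis.repr (schur nu) = Finsupp.single nu 1 := by
    rw [← schurBasis.repr_self nu]
    simp [schurBasis]
  rw [hallInner, h, h, Finsupp.sum_single_index (by simp), Finsupp.single_apply, one_mul]
  simp only [eq_comm]

/-! ### Multisets of partitions and the cone -/

/-- The product `s_A` of the Schur functions of the members of `A`. -/
noncomputable def schurProd (A : Multiset Ptn) : SymFun := (A.map schur).prod

/-- The partition `φ(A)` whose parts are all the parts of all the members of `A`. -/
def phi (A : Multiset Ptn) : Ptn := A.join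

/-- The multisets `A` of nonempty partitions with at most `k` parts each, of total
size `N`. -/
def SP (k N : ℕ) : Set (Multiset Ptn) :=
  {A | (∀ lam ∈ A, 1 ≤ Multiset.card lam ∧ Multiset.card lam ≤ k) ∧ (A.map size).sum = N}

/-- `s_A` is extreme in the cone generated by the `s_B`, `B ∈ SP k N` (which is the cone of
log concavity for `k = 2`): it is one of these generators, and it is not a linear combination
with nonnegative coefficients of the other ones. -/
def IsExtremeInCone (k N : ℕ) (A : Multiset Ptn) : Prop :=
  A ∈ SP k N ∧ schurProd A ∉ PointedCone.hull ℝ (schurProd '' (SP k N \ {A}))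

/-- The forbidden pairs of partitions. -/
def Crossing (lam mu : Ptn) : Prop :=
  (Multiset.card lam = 2 ∧ Multiset.card mu = 2 ∧
    part mu 0 < part lam 0 ∧ part lam 1 ≤ part mu 0 ∧ part mu 1 < part lam 1) ∨
  (Multiset.card lam = 2 ∧ Multiset.card mu = 1 ∧
    part lam 1 < part lam 0 ∧ part mu 0 ≤ part lam 0 ∧ part lam 1 ≤ part mu 0) ∨
  (Multiset.card lam = 1 ∧ Multiset.card mu = 1)

/-- No pair of members of `A` (a sub-multiset, so two copies of one partition count as a pair
if `A` contains it twice) is forbidden. -/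
def Nested (A : Multiset Ptn) : Prop :=
  ∀ lam mu : Ptn, ({lam, mu} : Multiset Ptn) ≤ A → ¬ Crossing lam mu

/-- The nested multisets `A` with `φ(A) = lam`. -/
def SSP (lam : Ptn) : Set (Multiset Ptn) :=
  {A | A ∈ SP 2 (size lam) ∧ Nested A ∧ phi A = lam}

/-- All coefficients of `f` in the basis of Schur functions are integers. -/
def SchurIntegral (f : SymFun) : Prop :=
  ∀ mu : Ptn, ∃ z : ℤ, hallInner f (schur mu) = (z : ℝ)

/-- `f` separates `A` on the interval `[lam, rho]`, where `lam = φ(A)`. -/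
def SeparatesOn (f : SymFun) (A : Multiset Ptn) (lam rho : Ptn) : Prop :=
  (∀ mu : Ptn, mu ∉ domInterval lam rho → hallInner f (schur mu) = 0) ∧
  0 < hallInner f (schurProd A) ∧
  ∀ B ∈ SP 2 (size lam), phi B ∈ domInterval lam rho → B ≠ A → hallInner f (schurProd B) ≤ 0

end SchurCone

open SchurCone

/-!
Let `h_nu` be the product of the `h_k` over the parts `k` of `nu`. By the Jacobi-Trudi formula
`s_mu` is `h_mu` plus a combination of the `h_nu` with `nu` strictly above `mu` in dominance order
(`schur_sub_hMon_mem`), and the same holds for `s_B` and `phi B` (`schurProd_sub_hMon_mem`). So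
for `mu` and `phi B` above `lam` one can work with coefficients in the monomials `h_nu`. Dominance
is used in the form `DomLE`: the sums of `max (x - t) 0` over the parts `x` increase for each `t`.
These sums are additive in the multiset of parts, and replacing a pair `p ≥ q` of parts by
`p + 1, q - 1` increases them by one exactly for `q ≤ t ≤ p` (`tailSum_raise`).

Call a multiset of blocks of one or two parts with `phi B = lam` a decomposition of `lam`. Since
`s_{(p, q)} = h_p h_q - h_{p+1} h_{q-1}`, its `s_B` is the signed sum of the `h_nu`, where `nu`
arises from `lam` by raising a set of pairs of `B` (`Decomp.schurProd_eq`). Let `a` be a pair of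
the nested decomposition `A`, and suppose that all shorter pairs of `A` belong to `B` as well. If
`nu` lies below the partition where only `a` is raised, a set of pairs that produces `nu` lies
inside `a`. As `A` is nested, the parts strictly inside `a` are paired among themselves in `A`, by
shorter pairs, hence in the same way in `B`. Thus `s_A` and `s_B` have the same coefficient at
`nu`, unless `a` is not in `B` and `nu` is that top partition, where `s_A` has the smaller
coefficient, by one (`hCoeff_eq_of_shorter`). Since `A` has at most one single part, each other
decomposition `B` misses some pair of `A` (`exists_pair_not_mem`).

The functional `F` is the coefficient of `h_lam` plus a weighted sum of the functionals
`levelDiff lam A k`, which vanish at `s_A`; so `F s_A = 1`. They collect the coefficients in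
certain regions of partitions, ordered lexicographically by the length of a pair of `A` and by the
sum of squares of the parts. For all `B ≠ A` the first nonzero `levelDiff` at `s_B` is negative:
if `phi B = lam` it comes from a shortest pair of `A` missing in `B` (`levelDiff_of_phi_eq`), and
otherwise from the leading monomial of `s_B`, unless all terms vanish (`levelDiff_of_phi_ne`).
With rapidly decreasing integer weights (`exists_weights`) this gives `F s_B ≤ 0`. Region `0`
consists of the partitions not above `lam`, so that the inequality holds without any condition on
`phi B`; this proves that `A` is extreme. The symmetric function `f` represents `F` on the span of
the `s_mu` with `mu` above `lam`, and it is supported on the interval because all regions other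
than region `0` lie below partitions obtained from `lam` by raising one pair, which are below
`plus lam` (`raised_singleton_le_plus`).
-/

namespace SchurCone

/-! ### Parts of a partition -/

theorem prod_map_filterMap {M α β : Type*} [CommMonoid M] (φ : β → M) (ψ : α → M)
    (g : α → Option β) (h : ∀ i, ψ i = (g i).elim 1 φ) (s : Multiset α) :
    ((s.filterMap g).map φ).prod = (s.map ψ).prod := by
  induction s using Multiset.induction_on with
  | empty => simp
  | cons i s ih =>
    rw [Multiset.map_cons, Multiset.prod_cons, h, ← ih]
    cases hg : g i with
    | none => simp [Multiset.filterMap_cons_none _ _ hg]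
    | some b => simp [Multiset.filterMap_cons_some _ _ _ hg]

theorem prod_map_ofSeq {M : Type*} [CommMonoid M] (φ : ℕ → M) (h0 : φ 0 = 1) (n : ℕ)
    (a : ℕ → ℕ) :
    ((ofSeq n a).map fun k : ℕ+ => φ k).prod = ∏ i ∈ Finset.range n, φ (a i) := by
  refine prod_map_filterMap _ (fun i => φ (a i)) _ (fun i => ?_) _
  by_cases h : 0 < a i
  · rw [dif_pos h]; rfl
  · rw [dif_neg h, Nat.eq_zero_of_not_pos h, h0]; rfl

theorem sum_map_ofSeq {M : Type*} [AddCommMonoid M] (φ : ℕ → M) (h0 : φ 0 = 0) (n : ℕ)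
    (a : ℕ → ℕ) :
    ((ofSeq n a).map fun k : ℕ+ => φ k).sum = ∑ i ∈ Finset.range n, φ (a i) :=
  prod_map_ofSeq (M := Multiplicative M) φ h0 n a

theorem part_eq_getElem (lam : Ptn) {i : ℕ} (hi : i < (lam.sort (fun a b => b ≤ a)).length) :
    part lam i = (lam.sort (fun a b => b ≤ a))[i] := by
  unfold part
  rw [List.getD_eq_getElem _ _ (by simpa using hi), List.getElem_map]

theorem sum_map_part {M : Type*} [AddCommMonoid M] (φ : ℕ → M) (lam : Ptn) :
    (lam.map fun k : ℕ+ => φ k).sum = ∑ i ∈ Finset.range (Multiset.card lam), φ (part lam i) := by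
  have hl : (lam.sort (fun a b => b ≤ a)).length = Multiset.card lam := by simp
  conv_lhs => rw [← Multiset.sort_eq lam (fun a b => b ≤ a)]
  rw [Multiset.map_coe, Multiset.sum_coe, ← Fin.sum_univ_getElem, Finset.sum_range]
  refine Fintype.sum_equiv (finCongr (by simp)) _ _ fun i => ?_
  rw [List.getElem_map, finCongr_apply_coe, part_eq_getElem]

theorem part_mem {lam : Ptn} {i : ℕ} (hi : i < Multiset.card lam) :
    ∃ k ∈ lam, (k : ℕ) = part lam i := by
  have hl : i < (lam.sort (fun a b => b ≤ a)).length := by simpa using hi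
  refine ⟨(lam.sort (fun a b => b ≤ a))[i], ?_, ?_⟩
  · rw [← Multiset.mem_sort (r := fun a b => b ≤ a)]; exact List.getElem_mem hl
  · rw [part_eq_getElem]

theorem part_eq_zero {lam : Ptn} {i : ℕ} (hi : Multiset.card lam ≤ i) : part lam i = 0 := by
  unfold part
  rw [List.getD_eq_default _ _ (by simpa using hi)]

theorem exists_part_eq {lam : Ptn} {k : ℕ+} (hk : k ∈ lam) :
    ∃ i < Multiset.card lam, part lam i = k := by
  rw [← Multiset.mem_sort (r := fun a b => b ≤ a), List.mem_iff_getElem] at hk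
  obtain ⟨i, hi, rfl⟩ := hk
  exact ⟨i, by simpa using hi, part_eq_getElem lam hi⟩

/-! ### Dominance by truncated sums -/

/-- The sum of `max (x - t) 0` over the parts `x` of `nu`. -/
def tailSum (t : ℕ) (nu : Ptn) : ℕ := (nu.map fun k : ℕ+ => (k : ℕ) - t).sum

theorem tailSum_add (t : ℕ) (mu nu : Ptn) : tailSum t (mu + nu) = tailSum t mu + tailSum t nu := by
  simp [tailSum]

theorem size_add (mu nu : Ptn) : size (mu + nu) = size mu + size nu := by simp [size]

theorem sqSize_add (mu nu : Ptn) : sqSize (mu + nu) = sqSize mu + sqSize nu := by simp [sqSize]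

theorem tailSum_zero (nu : Ptn) : tailSum 0 nu = size nu := by simp [tailSum, size]

/-- The dominance order, increasing to the right, expressed by truncated sums. Unlike partial
sums of sorted sequences, these are additive in the multiset of parts. -/
def DomLE (mu nu : Ptn) : Prop := size mu = size nu ∧ ∀ t, tailSum t mu ≤ tailSum t nu

theorem DomLE.refl (mu : Ptn) : DomLE mu mu := ⟨rfl, fun _ => le_rfl⟩

theorem DomLE.trans {mu nu rho : Ptn} (h : DomLE mu nu) (h' : DomLE nu rho) : DomLE mu rho :=
  ⟨h.1.trans h'.1, fun t => (h.2 t).trans (h'.2 t)⟩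

theorem DomLE.add {mu nu mu' nu' : Ptn} (h : DomLE mu nu) (h' : DomLE mu' nu') :
    DomLE (mu + mu') (nu + nu') :=
  ⟨by rw [size_add, size_add, h.1, h'.1], fun t => by
    rw [tailSum_add, tailSum_add]; exact add_le_add (h.2 t) (h'.2 t)⟩

theorem tailSum_eq_sum_part (t : ℕ) (lam : Ptn) {n : ℕ} (hn : Multiset.card lam ≤ n) :
    tailSum t lam = ∑ i ∈ Finset.range n, (part lam i - t) := by
  rw [tailSum, sum_map_part (fun k => k - t)]
  refine Finset.sum_subset (Finset.range_subset_range.2 hn) fun i _ hi => ?_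
  rw [part_eq_zero (by simpa using hi)]; simp

theorem sum_part_le (lam : Ptn) (n t : ℕ) :
    ∑ i ∈ Finset.range n, part lam i ≤ tailSum t lam + n * t := by
  rw [tailSum_eq_sum_part t lam (le_max_left _ n)]
  calc ∑ i ∈ Finset.range n, part lam i
      ≤ ∑ i ∈ Finset.range n, ((part lam i - t) + t) := Finset.sum_le_sum fun i _ => by omega
    _ = ∑ i ∈ Finset.range n, (part lam i - t) + n * t := by simp [Finset.sum_add_distrib]
    _ ≤ _ := by
      gcongr
      exact le_max_right _ _

/-- The truncated sum at the `n`-th part computes the sum of the `n` largest parts. -/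
theorem sum_part_eq (lam : Ptn) (n : ℕ) :
    ∑ i ∈ Finset.range n, part lam i = tailSum (part lam n) lam + n * part lam n := by
  refine le_antisymm (sum_part_le _ _ _) ?_
  rw [tailSum_eq_sum_part _ lam (le_max_left _ n),
    ← Finset.sum_subset (Finset.range_subset_range.2 (le_max_right (Multiset.card lam) n))]
  · have : n * part lam n = ∑ i ∈ Finset.range n, part lam n := by simp
    rw [this, ← Finset.sum_add_distrib]
    refine Finset.sum_le_sum fun i hi => ?_
    have := part_anti lam (Finset.mem_range.1 hi).le
    omega
  · intro i _ hi
    have := part_anti lam (not_lt.1 (mt Finset.mem_range.2 hi))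
    omega

/-- Conversely, each truncated sum is computed by a sum of largest parts, those greater than
`t`. -/
theorem exists_tailSum_eq (lam : Ptn) (t : ℕ) :
    ∃ n, ∑ i ∈ Finset.range n, part lam i = tailSum t lam + n * t := by
  have hex : ∃ n, part lam n ≤ t := ⟨Multiset.card lam, by rw [part_eq_zero le_rfl]; simp⟩
  classical
  refine ⟨Nat.find hex, ?_⟩
  set n := Nat.find hex with hn
  have h1 : part lam n ≤ t := Nat.find_spec hex
  have h2 : ∀ i < n, t < part lam i := fun i hi => not_le.1 (Nat.find_min hex hi)
  rw [tailSum_eq_sum_part _ lam (le_max_left _ n),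
    ← Finset.sum_subset (Finset.range_subset_range.2 (le_max_right (Multiset.card lam) n))]
  · have : n * t = ∑ i ∈ Finset.range n, t := by simp
    rw [this, ← Finset.sum_add_distrib]
    refine Finset.sum_congr rfl fun i hi => ?_
    have := h2 i (Finset.mem_range.1 hi)
    omega
  · intro i _ hi
    have := part_anti lam (not_lt.1 (mt Finset.mem_range.2 hi))
    omega

theorem dominates_iff (lam mu : Ptn) : Dominates lam mu ↔ DomLE mu lam := by
  constructor
  · rintro ⟨h1, h2⟩
    refine ⟨h1.symm, fun t => ?_⟩
    obtain ⟨n, hn⟩ := exists_tailSum_eq mu t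
    have := h2 n
    have := sum_part_le lam n t
    omega
  · rintro ⟨h1, h2⟩
    refine ⟨h1.symm, fun n => ?_⟩
    rw [sum_part_eq lam n]
    have := sum_part_le mu n (part lam n)
    have := h2 (part lam n)
    omega

theorem part_le_size (lam : Ptn) {k : ℕ+} (hk : k ∈ lam) : (k : ℕ) ≤ size lam :=
  Multiset.le_sum_of_mem (Multiset.mem_map_of_mem (fun k : ℕ+ => (k : ℕ)) hk)

/-- The sum of squares is determined by the truncated sums, as `x ^ 2 + x` is twice the sum of
`x - t` over `t < n` for `x ≤ n`. -/
theorem sqSize_add_size_eq (lam : Ptn) {n : ℕ} (hn : ∀ k ∈ lam, (k : ℕ) ≤ n) :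
    sqSize lam + size lam = 2 * ∑ t ∈ Finset.range n, tailSum t lam := by
  have key : ∀ x n : ℕ, x ≤ n → x ^ 2 + x = 2 * ∑ t ∈ Finset.range n, (x - t) := by
    intro x n hx
    induction n, hx using Nat.le_induction with
    | base =>
      induction x with
      | zero => simp
      | succ x ih =>
        rw [Finset.sum_range_succ', Finset.sum_congr rfl fun t _ => Nat.add_sub_add_right x 1 t]
        simp only [Nat.sub_zero]
        linarith
    | succ n hx ih => rw [Finset.sum_range_succ, Nat.sub_eq_zero_of_le hx, add_zero, ih]
  induction lam using Multiset.induction_on with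
  | empty => simp [sqSize, size, tailSum]
  | cons k lam ih =>
    have h1 := ih fun j hj => hn j (Multiset.mem_cons_of_mem hj)
    have h2 := key k n (hn k (Multiset.mem_cons_self k lam))
    simp only [sqSize, size, tailSum, Multiset.map_cons, Multiset.sum_cons,
      Finset.sum_add_distrib] at h1 ⊢
    linarith

theorem DomLE.sqSize_le {mu nu : Ptn} (h : DomLE mu nu) : sqSize mu ≤ sqSize nu := by
  have h1 := sqSize_add_size_eq mu fun k hk => part_le_size mu hk
  have h2 := sqSize_add_size_eq nu fun k hk => part_le_size nu hk
  rw [← h.1] at h2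
  have h3 : ∑ t ∈ Finset.range (size mu), tailSum t mu ≤
      ∑ t ∈ Finset.range (size mu), tailSum t nu :=
    Finset.sum_le_sum fun t _ => h.2 t
  omega

/-- Strict dominance. The inequality between the sums of squares is a convenient way to
express strictness. -/
def DomLT (mu nu : Ptn) : Prop := DomLE mu nu ∧ sqSize mu < sqSize nu

theorem DomLT.add_le {mu nu mu' nu' : Ptn} (h : DomLT mu nu) (h' : DomLE mu' nu') :
    DomLT (mu + mu') (nu + nu') :=
  ⟨h.1.add h', by
    have := h.2; have := h'.sqSize_le; rw [sqSize_add, sqSize_add]; omega⟩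

/-! ### Triangularity -/

theorem hMon_add (mu nu : Ptn) : hMon (mu + nu) = hMon mu * hMon nu := by
  simp [hMon_eq]

theorem hMon_ofSeq (n : ℕ) (a : ℕ → ℕ) :
    hMon (ofSeq n a) = ∏ i ∈ Finset.range n, hFun (a i) := by
  rw [hMon_eq, ← prod_map_ofSeq (fun k : ℕ => hFun k) (by simp [hFun])]
  simp only [h_coe]

theorem tailSum_ofSeq (t n : ℕ) (a : ℕ → ℕ) :
    tailSum t (ofSeq n a) = ∑ i ∈ Finset.range n, (a i - t) :=
  sum_map_ofSeq (fun k : ℕ => k - t) (by simp) n a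

theorem sqSize_ofSeq (n : ℕ) (a : ℕ → ℕ) : sqSize (ofSeq n a) = ∑ i ∈ Finset.range n, a i ^ 2 :=
  sum_map_ofSeq (fun k : ℕ => k ^ 2) rfl n a

/-- Among all orders of `0, …, m - 1`, the natural one minimizes the sum over an initial
segment; so the rearranged parts in a Jacobi-Trudi term have larger truncated sums. -/
theorem tailSum_le_sum_perm (lam : Ptn) (σ : Equiv.Perm (Fin (Multiset.card lam))) (t : ℕ) :
    (tailSum t lam : ℤ) ≤
      ∑ i, max ((part lam (σ i) : ℤ) - ((σ i : ℕ) : ℤ) + ((i : ℕ) : ℤ) - t) 0 := by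
  set J : Fin (Multiset.card lam) → ℤ := fun i => if t < part lam i then 1 else 0 with hJ
  set g : Fin (Multiset.card lam) → ℤ := fun i => ((i : ℕ) : ℤ) with hg
  have hav : Antivary J g := by
    intro i j hij
    have hij : (i : ℕ) ≤ (j : ℕ) := by simp only [hg] at hij; omega
    have := part_anti lam hij
    simp only [hJ]
    split_ifs <;> omega
  have hre := hav.sum_mul_le_sum_comp_perm_mul (σ := σ)
  have e1 := Equiv.sum_comp σ fun i => J i * ((part lam i : ℤ) - t - g i)
  have e2 : (tailSum t lam : ℤ) = ∑ i, J i * ((part lam i : ℤ) - t) := by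
    rw [tailSum_eq_sum_part t lam le_rfl, Finset.sum_range]
    push_cast
    refine Finset.sum_congr rfl fun i _ => ?_
    simp only [hJ]
    split_ifs <;> omega
  calc (tailSum t lam : ℤ) = ∑ i, J i * ((part lam i : ℤ) - t - g i) + ∑ i, J i * g i := by
        rw [e2, ← Finset.sum_add_distrib]
        exact Finset.sum_congr rfl fun i _ => by ring
    _ ≤ ∑ i, J (σ i) * ((part lam (σ i) : ℤ) - t - g (σ i)) + ∑ i, J (σ i) * g i := by
        rw [e1]; gcongr
    _ ≤ _ := by
        rw [← Finset.sum_add_distrib]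
        refine Finset.sum_le_sum fun i _ => ?_
        simp only [hJ, hg]
        split_ifs
        · refine le_trans (le_of_eq ?_) (le_max_left _ _); ring
        · simp

/-- The truncated sums of `nu` read off from a factorization of `h_nu`; the exponents are
nonnegative since `h_n = 0` for `n < 0`. -/
theorem prod_h_eq {ι : Type} [Fintype ι] (a : ι → ℤ) {nu : Ptn}
    (h : ∏ i, hFun (a i) = hMon nu) (t : ℕ) : (tailSum t nu : ℤ) = ∑ i, max (a i - t) 0 := by
  classical
  have hnn : ∀ i, 0 ≤ a i := by
    intro i
    by_contra hi
    have h0 : hFun (a i) = 0 := by rw [hFun, dif_neg (by omega), if_neg (by omega)]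
    rw [Finset.prod_eq_zero (Finset.mem_univ i) h0, eq_comm, hMon,
      MvPolynomial.monomial_eq_zero] at h
    exact one_ne_zero h
  -- the statement for subproducts; `hMon_injective` identifies the partition for the full one
  suffices H : ∀ s : Finset ι, ∃ mu, ∏ i ∈ s, hFun (a i) = hMon mu ∧
      (tailSum t mu : ℤ) = ∑ i ∈ s, max (a i - t) 0 by
    obtain ⟨mu, h1, h2⟩ := H Finset.univ
    rw [h] at h1
    rw [hMon_injective h1, h2]
  intro s
  induction s using Finset.induction_on with
  | empty => exact ⟨0, by simp [hMon], by simp [tailSum]⟩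
  | insert i s hi ih =>
    obtain ⟨mu, h1, h2⟩ := ih
    refine ⟨ofSeq 1 (fun _ => (a i).toNat) + mu, ?_, ?_⟩
    · rw [Finset.prod_insert hi, hMon_add, hMon_ofSeq, h1]
      simp [hnn i]
    · rw [Finset.sum_insert hi, tailSum_add, tailSum_ofSeq, ← h2]
      have := hnn i
      simp only [Finset.sum_range_one]
      omega

/-- The span of the monomials `h_nu` with `nu` strictly above `mu` in dominance order. -/
noncomputable def upper (mu : Ptn) : Submodule ℝ SymFun :=
  Submodule.span ℝ (hMon '' {nu | DomLT mu nu})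

theorem schur_sub_hMon_mem (lam : Ptn) : schur lam - hMon lam ∈ upper lam := by
  rw [schur, Matrix.det_apply, ← Finset.add_sum_erase _ _ (Finset.mem_univ 1)]
  simp only [Matrix.of_apply]
  rw [term_diagonal, Equiv.Perm.sign_one, one_smul, add_sub_cancel_left]
  refine Submodule.sum_mem _ fun σ hσ => ?_
  rw [Units.smul_def]
  refine zsmul_mem ?_ _
  rcases term_off_diagonal lam σ (Finset.ne_of_mem_erase hσ) with h0 | ⟨nu, h1, h2, h3⟩
  · rw [h0]; exact Submodule.zero_mem _
  · rw [h1]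
    refine Submodule.subset_span ⟨nu, ⟨⟨h2.symm, fun t => ?_⟩, h3⟩, rfl⟩
    have e := prod_h_eq _ h1 t
    have := tailSum_le_sum_perm lam σ t
    rw [← e] at this
    exact_mod_cast this

theorem upper_mul_hMon {mu : Ptn} {x : SymFun} (hx : x ∈ upper mu) {nu rho : Ptn}
    (h : DomLE nu rho) : x * hMon rho ∈ upper (mu + nu) := by
  induction hx using Submodule.span_induction with
  | mem x hx =>
    obtain ⟨k, hk, rfl⟩ := hx
    rw [← hMon_add]
    exact Submodule.subset_span ⟨_, DomLT.add_le hk h, rfl⟩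
  | zero => rw [zero_mul]; exact Submodule.zero_mem _
  | add x y _ _ hx hy => rw [add_mul]; exact Submodule.add_mem _ hx hy
  | smul c x _ hx => rw [smul_mul_assoc]; exact Submodule.smul_mem _ _ hx

theorem upper_mul_upper {mu nu : Ptn} {x y : SymFun} (hx : x ∈ upper mu) (hy : y ∈ upper nu) :
    x * y ∈ upper (mu + nu) := by
  induction hy using Submodule.span_induction with
  | mem y hy =>
    obtain ⟨k, hk, rfl⟩ := hy
    exact upper_mul_hMon hx hk.1
  | zero => rw [mul_zero]; exact Submodule.zero_mem _
  | add y z _ _ hy hz => rw [mul_add]; exact Submodule.add_mem _ hy hz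
  | smul c y _ hy => rw [mul_smul_comm]; exact Submodule.smul_mem _ _ hy

theorem schurProd_sub_hMon_mem (B : Multiset Ptn) : schurProd B - hMon (phi B) ∈ upper (phi B) := by
  induction B using Multiset.induction_on with
  | empty => simp [schurProd, phi, hMon]
  | cons b B ih =>
    have e : schurProd (b ::ₘ B) - hMon (phi (b ::ₘ B)) =
        (schur b - hMon b) * (schurProd B - hMon (phi B)) + (schur b - hMon b) * hMon (phi B) +
          (schurProd B - hMon (phi B)) * hMon b := by
      simp only [phi, Multiset.join_cons, hMon_add, schurProd, Multiset.map_cons,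
        Multiset.prod_cons]
      ring
    rw [e]
    have hb := schur_sub_hMon_mem b
    have hphi : phi (b ::ₘ B) = b + phi B := by simp [phi]
    rw [hphi]
    refine Submodule.add_mem _ (Submodule.add_mem _ (upper_mul_upper hb ih)
      (upper_mul_hMon hb (DomLE.refl _))) ?_
    rw [add_comm]
    exact upper_mul_hMon ih (DomLE.refl _)

/-- The coefficient of the monomial `h_nu`. -/
noncomputable def hCoeff (nu : Ptn) : SymFun →ₗ[ℝ] ℝ :=
  MvPolynomial.lcoeff ℝ (Multiset.toFinsupp nu)

theorem hCoeff_hMon (nu mu : Ptn) : hCoeff nu (hMon mu) = if mu = nu then 1 else 0 :=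
  coeff_hMon mu nu

theorem hCoeff_upper {mu nu : Ptn} {x : SymFun} (hx : x ∈ upper mu) (h : hCoeff nu x ≠ 0) :
    DomLT mu nu := by
  by_contra hc
  refine h (Submodule.span_induction (p := fun x _ => hCoeff nu x = 0) ?_ (by simp) ?_ ?_ hx)
  · rintro _ ⟨k, hk, rfl⟩
    rw [hCoeff_hMon, if_neg]
    rintro rfl
    exact hc hk
  · intro x y _ _ hx hy; rw [map_add, hx, hy, add_zero]
  · intro c x _ hx; rw [map_smul, hx, smul_zero]

theorem hCoeff_leading {x : SymFun} {mu : Ptn} (hx : x - hMon mu ∈ upper mu) :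
    hCoeff mu x = 1 ∧ ∀ nu, hCoeff nu x ≠ 0 → nu = mu ∨ DomLT mu nu := by
  have e : ∀ nu, hCoeff nu x = (if mu = nu then 1 else 0) + hCoeff nu (x - hMon mu) := fun nu => by
    rw [map_sub, hCoeff_hMon]; ring
  constructor
  · rw [e, if_pos rfl, add_eq_left]
    by_contra h
    exact lt_irrefl _ (hCoeff_upper hx h).2
  · intro nu hnu
    by_cases h : mu = nu
    · exact Or.inl h.symm
    · rw [e, if_neg h, zero_add] at hnu
      exact Or.inr (hCoeff_upper hx hnu)

theorem hCoeff_schurProd_self (B : Multiset Ptn) : hCoeff (phi B) (schurProd B) = 1 :=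
  (hCoeff_leading (schurProd_sub_hMon_mem B)).1

theorem hCoeff_schurProd_ne_zero {B : Multiset Ptn} {nu : Ptn}
    (h : hCoeff nu (schurProd B) ≠ 0) : nu = phi B ∨ DomLT (phi B) nu :=
  (hCoeff_leading (schurProd_sub_hMon_mem B)).2 nu h

/-- The span of the Schur functions `s_mu` with `mu` above `lam` in dominance order. -/
noncomputable def schurAbove (lam : Ptn) : Submodule ℝ SymFun :=
  Submodule.span ℝ (schur '' {mu | DomLE lam mu})

/-- Triangularity is inverted by induction on the sum of squares, which is at most
`size mu ^ 2`. -/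
theorem hMon_mem_schurAbove {lam mu : Ptn} (h : DomLE lam mu) : hMon mu ∈ schurAbove lam := by
  induction hn : size mu ^ 2 - sqSize mu using Nat.strong_induction_on generalizing mu with
  | _ n ih =>
    have e : hMon mu = schur mu - (schur mu - hMon mu) := by ring
    rw [e]
    refine Submodule.sub_mem _ (Submodule.subset_span ⟨mu, h, rfl⟩) ?_
    refine (Submodule.span_le.2 ?_ : upper mu ≤ _) (schur_sub_hMon_mem mu)
    rintro _ ⟨nu, hnu, rfl⟩
    refine ih _ ?_ (h.trans hnu.1) rfl
    have h1 := hnu.2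
    have h2 := sqSize_le nu
    rw [← hnu.1.1] at h2 ⊢
    omega

theorem schurProd_mem_schurAbove {lam : Ptn} {B : Multiset Ptn} (h : DomLE lam (phi B)) :
    schurProd B ∈ schurAbove lam := by
  have e : schurProd B = hMon (phi B) + (schurProd B - hMon (phi B)) := by ring
  rw [e]
  refine Submodule.add_mem _ (hMon_mem_schurAbove h) ?_
  refine (Submodule.span_le.2 ?_ : upper (phi B) ≤ _) (schurProd_sub_hMon_mem B)
  rintro _ ⟨nu, hnu, rfl⟩
  exact hMon_mem_schurAbove (h.trans hnu.1)

/-! ### Integrality -/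

/-- The polynomials with integer coefficients. -/
noncomputable def intPoly : Subring SymFun := (MvPolynomial.map (Int.castRingHom ℝ)).range

theorem hFun_mem_intPoly (n : ℤ) : hFun n ∈ intPoly := by
  unfold hFun
  split_ifs
  · exact ⟨MvPolynomial.X _, MvPolynomial.map_X _ _⟩
  · exact Subring.one_mem _
  · exact Subring.zero_mem _

theorem schur_mem_intPoly (lam : Ptn) : schur lam ∈ intPoly := by
  rw [schur, Matrix.det_apply]
  refine Subring.sum_mem _ fun σ _ => ?_
  rw [Units.smul_def]
  exact zsmul_mem (Subring.prod_mem _ fun i _ => hFun_mem_intPoly _) _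

theorem schurProd_mem_intPoly (B : Multiset Ptn) : schurProd B ∈ intPoly := by
  refine Subring.multiset_prod_mem _ _ fun x hx => ?_
  obtain ⟨b, _, rfl⟩ := Multiset.mem_map.1 hx
  exact schur_mem_intPoly b

theorem hCoeff_intPoly {x : SymFun} (hx : x ∈ intPoly) (nu : Ptn) : ∃ z : ℤ, hCoeff nu x = z := by
  obtain ⟨y, rfl⟩ := hx
  exact ⟨_, MvPolynomial.coeff_map (Int.castRingHom ℝ) y _⟩

/-! ### Raising pairs -/

/-- For a partition with two parts `p ≥ q`, the partition `(p + 1, q - 1)`, so that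
`s_{(p, q)} = h_p h_q - h_{p+1} h_{q-1}` is the difference of the two monomials. -/
def raise (b : Ptn) : Ptn := ofSeq 2 fun i => if i = 0 then part b 0 + 1 else part b 1 - 1

theorem eq_singleton_of_card {b : Ptn} (h : Multiset.card b = 1) :
    ∃ p : ℕ+, b = {p} ∧ part b 0 = p := by
  obtain ⟨p, rfl⟩ := Multiset.card_eq_one.1 h
  obtain ⟨k, hk, hk'⟩ := part_mem (lam := {p}) (i := 0) (by simp)
  rw [Multiset.mem_singleton.1 hk] at hk'
  exact ⟨p, rfl, hk'.symm⟩

theorem eq_pair_of_card {b : Ptn} (h : Multiset.card b = 2) :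
    ∃ p q : ℕ+, b = {p, q} ∧ part b 0 = p ∧ part b 1 = q ∧ q ≤ p := by
  have hl : (b.sort (fun a b => b ≤ a)).length = 2 := by simpa using h
  refine ⟨(b.sort (fun a b => b ≤ a))[0], (b.sort (fun a b => b ≤ a))[1], ?_,
    part_eq_getElem b _, part_eq_getElem b _, ?_⟩
  · conv_lhs => rw [← Multiset.sort_eq b (fun a b => b ≤ a)]
    obtain ⟨x, y, hxy⟩ := List.length_eq_two.1 hl
    simp only [hxy]
    rfl
  · rw [← PNat.coe_le_coe, ← part_eq_getElem, ← part_eq_getElem]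
    exact part_anti b (Nat.zero_le 1)

theorem det_of_card_two {R : Type*} [CommRing R] {n : ℕ} (h : n = 2) (M : ℕ → ℕ → R) :
    Matrix.det (Matrix.of fun i j : Fin n => M i j) = M 0 0 * M 1 1 - M 0 1 * M 1 0 := by
  subst h
  simp [Matrix.det_fin_two]

theorem schur_of_card_one {b : Ptn} (h : Multiset.card b = 1) : schur b = hMon b := by
  rw [← prod_h_part, schur]
  generalize Multiset.card b = n at h
  subst h
  simp

theorem schur_of_card_two {b : Ptn} (h : Multiset.card b = 2) :
    schur b = hMon b - hMon (raise b) := by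
  rw [← prod_h_part, schur, det_of_card_two h fun i j => hFun ((part b i : ℤ) - i + j), raise,
    hMon_ofSeq, Finset.prod_range_succ, Finset.prod_range_one]
  have h2 : ∏ i : Fin (Multiset.card b), hFun (part b i : ℤ) =
      hFun (part b 0 : ℤ) * hFun (part b 1 : ℤ) := by
    rw [← Finset.prod_range fun i => hFun (part b i : ℤ), h, Finset.prod_range_succ,
      Finset.prod_range_one]
  obtain ⟨p, q, -, -, hq, -⟩ := eq_pair_of_card h
  have := q.pos
  rw [h2]
  congr 2
  · simp
  · congr 1
    simp only [one_ne_zero, if_false, Nat.cast_one, Nat.cast_zero]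
    omega

theorem tailSum_of_card_two {b : Ptn} (h : Multiset.card b = 2) (t : ℕ) :
    tailSum t b = (part b 0 - t) + (part b 1 - t) := by
  rw [tailSum_eq_sum_part t b h.le, Finset.sum_range_succ, Finset.sum_range_one]

theorem part_one_pos {b : Ptn} (h : Multiset.card b = 2) : 0 < part b 1 := by
  obtain ⟨p, q, -, -, hq, -⟩ := eq_pair_of_card h
  rw [hq]; exact q.pos

theorem tailSum_raise {b : Ptn} (h : Multiset.card b = 2) (t : ℕ) :
    tailSum t (raise b) = tailSum t b + if part b 1 ≤ t ∧ t ≤ part b 0 then 1 else 0 := by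
  have h1 := part_one_pos h
  have h2 := part_anti b (Nat.zero_le 1)
  rw [raise, tailSum_ofSeq, tailSum_of_card_two h, Finset.sum_range_succ, Finset.sum_range_one]
  simp only [if_true, one_ne_zero, if_false]
  split_ifs <;> omega

theorem sqSize_raise {b : Ptn} (h : Multiset.card b = 2) :
    sqSize (raise b) = sqSize b + 2 * (part b 0 - part b 1) + 2 := by
  have h1 := part_one_pos h
  have h2 := part_anti b (Nat.zero_le 1)
  have e : sqSize b = part b 0 ^ 2 + part b 1 ^ 2 := by
    have := sum_map_part (fun k => k ^ 2) b
    rw [h, Finset.sum_range_succ, Finset.sum_range_one] at this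
    exact this
  rw [raise, sqSize_ofSeq, e, Finset.sum_range_succ, Finset.sum_range_one]
  simp only [if_true, one_ne_zero, if_false]
  zify [h1, h2, (by omega : 1 ≤ part b 1)]
  ring

/-- The partition obtained from `lam` by raising the pairs in `T`, which are disjoint
sub-multisets of `lam`. -/
def raised (lam : Ptn) (T : Finset Ptn) : Ptn := lam - ∑ b ∈ T, b + ∑ b ∈ T, raise b

theorem tailSum_raised {lam : Ptn} {T : Finset Ptn} (hT : ∑ b ∈ T, b ≤ lam)
    (h2 : ∀ b ∈ T, Multiset.card b = 2) (t : ℕ) :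
    tailSum t (raised lam T) =
      tailSum t lam + (T.filter fun b => part b 1 ≤ t ∧ t ≤ part b 0).card := by
  have e : tailSum t lam = tailSum t (lam - ∑ b ∈ T, b) + tailSum t (∑ b ∈ T, b) := by
    rw [← tailSum_add, Multiset.sub_add_cancel hT]
  have hs : ∀ g : Ptn → Ptn, tailSum t (∑ b ∈ T, g b) = ∑ b ∈ T, tailSum t (g b) := fun g =>
    map_sum (⟨⟨tailSum t, by simp [tailSum]⟩, tailSum_add t⟩ : Ptn →+ ℕ) g T
  rw [raised, tailSum_add, e, hs, hs fun b => b, Finset.card_filter, add_assoc,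
    ← Finset.sum_add_distrib]
  exact congrArg _ (Finset.sum_congr rfl fun b hb => tailSum_raise (h2 b hb) t)

theorem sqSize_raised_singleton {lam b : Ptn} (hb : b ≤ lam) (h : Multiset.card b = 2) :
    sqSize (raised lam {b}) = sqSize lam + 2 * (part b 0 - part b 1) + 2 := by
  have e : sqSize lam = sqSize (lam - b) + sqSize b := by
    rw [← sqSize_add, Multiset.sub_add_cancel hb]
  rw [raised, Finset.sum_singleton, Finset.sum_singleton, sqSize_add, sqSize_raise h, e]
  ring

/-! ### Decompositions of a partition with distinct parts -/

/-- `B` is a decomposition of `lam` into blocks of one or two parts. -/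
def Decomp (lam : Ptn) (B : Multiset Ptn) : Prop :=
  (∀ b ∈ B, 1 ≤ Multiset.card b ∧ Multiset.card b ≤ 2) ∧ phi B = lam

/-- The blocks of `B` with two parts. -/
def pairs (B : Multiset Ptn) : Finset Ptn := B.toFinset.filter fun b => Multiset.card b = 2

theorem mem_pairs {B : Multiset Ptn} {b : Ptn} : b ∈ pairs B ↔ b ∈ B ∧ Multiset.card b = 2 := by
  simp [pairs]

theorem Decomp.add_le {lam : Ptn} {B : Multiset Ptn} (hB : Decomp lam B) {b c : Ptn}
    (h : ({b, c} : Multiset Ptn) ≤ B) : b + c ≤ lam := by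
  obtain ⟨C, rfl⟩ := Multiset.le_iff_exists_add.1 h
  rw [← hB.2, phi, Multiset.join_add]
  refine le_trans (le_of_eq ?_) (Multiset.le_add_right _ _)
  simp [Multiset.join]

theorem Decomp.le {lam : Ptn} {B : Multiset Ptn} (hB : Decomp lam B) {b : Ptn} (hb : b ∈ B) :
    b ≤ lam := by
  obtain ⟨C, rfl⟩ := Multiset.exists_cons_of_mem hb
  rw [← hB.2, phi, Multiset.join_cons]
  exact Multiset.le_add_right _ _

theorem pair_le {B : Multiset Ptn} {b c : Ptn} (hb : b ∈ B) (hc : c ∈ B) (hbc : b ≠ c) :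
    ({b, c} : Multiset Ptn) ≤ B := by
  obtain ⟨C, rfl⟩ := Multiset.exists_cons_of_mem hb
  refine Multiset.cons_le_cons _ (Multiset.singleton_le.2 ?_)
  exact (Multiset.mem_cons.1 hc).resolve_left hbc.symm

theorem Decomp.eq_of_mem {lam : Ptn} (hl : lam.Nodup) {B : Multiset Ptn} (hB : Decomp lam B)
    {b c : Ptn} (hb : b ∈ B) (hc : c ∈ B) {x : ℕ+} (hxb : x ∈ b) (hxc : x ∈ c) : b = c := by
  by_contra hbc
  have := Multiset.nodup_of_le (hB.add_le (pair_le hb hc hbc)) hl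
  exact Multiset.disjoint_left.1 (Multiset.nodup_add.1 this).2.2 hxb hxc

theorem Decomp.nodup {lam : Ptn} (hl : lam.Nodup) {B : Multiset Ptn} (hB : Decomp lam B) :
    B.Nodup := by
  refine Multiset.nodup_iff_le.2 fun b hb => ?_
  have h1 := hB.1 b (Multiset.mem_of_le hb (Multiset.mem_cons_self _ _))
  obtain ⟨x, hx⟩ := Multiset.card_pos_iff_exists_mem.1 h1.1
  have := Multiset.nodup_of_le (hB.add_le hb) hl
  exact Multiset.disjoint_left.1 (Multiset.nodup_add.1 this).2.2 hx hx

theorem Decomp.part_lt {lam : Ptn} (hl : lam.Nodup) {B : Multiset Ptn} (hB : Decomp lam B)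
    {b : Ptn} (hb : b ∈ B) (h2 : Multiset.card b = 2) : part b 1 < part b 0 := by
  obtain ⟨p, q, h, hp, hq, hle⟩ := eq_pair_of_card h2
  have hn := Multiset.nodup_of_le (hB.le hb) hl
  rw [hp, hq, PNat.coe_lt_coe]
  refine lt_of_le_of_ne hle ?_
  rintro rfl
  rw [h] at hn
  simp at hn

theorem sum_le_of_subset {lam : Ptn} {B : Multiset Ptn} (hB : Decomp lam B)
    {T : Finset Ptn} (hT : T ⊆ pairs B) : ∑ b ∈ T, b ≤ lam := by
  have h1 : T.val ≤ B := (Multiset.le_iff_subset T.nodup).2 fun b hb => (mem_pairs.1 (hT hb)).1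
  obtain ⟨C, rfl⟩ := Multiset.le_iff_exists_add.1 h1
  rw [← hB.2, phi, Multiset.join_add]
  refine le_trans (le_of_eq ?_) (Multiset.le_add_right _ _)
  rw [Finset.sum_eq_multiset_sum, Multiset.map_id']
  rfl

theorem hMon_sum (T : Finset Ptn) (g : Ptn → Ptn) : hMon (∑ b ∈ T, g b) = ∏ b ∈ T, hMon (g b) := by
  induction T using Finset.induction_on with
  | empty => simp [hMon]
  | insert b T hb ih => rw [Finset.sum_insert hb, Finset.prod_insert hb, hMon_add, ih]

theorem Decomp.schurProd_eq {lam : Ptn} (hl : lam.Nodup) {B : Multiset Ptn} (hB : Decomp lam B) :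
    schurProd B = ∑ T ∈ (pairs B).powerset, (-1) ^ T.card * hMon (raised lam T) := by
  have hn := hB.nodup hl
  have hval : B.toFinset.val = B := by rw [Multiset.toFinset_val, hn.dedup]
  have e1 : schurProd B = ∏ b ∈ B.toFinset, schur b := by
    rw [Finset.prod_eq_multiset_prod, hval]; rfl
  have e2 : lam = ∑ b ∈ B.toFinset, b := by
    rw [Finset.sum_eq_multiset_sum, hval, Multiset.map_id', ← hB.2]; rfl
  have hcard : ∀ b ∈ B.toFinset, ¬ Multiset.card b = 2 → Multiset.card b = 1 := by
    intro b hb h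
    have := hB.1 b (Multiset.mem_toFinset.1 hb)
    omega
  rw [e1, ← Finset.prod_filter_mul_prod_filter_not B.toFinset fun b => Multiset.card b = 2,
    Finset.prod_congr rfl fun b hb => schur_of_card_two (Finset.mem_filter.1 hb).2,
    Finset.prod_congr (s₁ := B.toFinset.filter fun b => ¬ Multiset.card b = 2) rfl fun b hb =>
      schur_of_card_one (hcard b (Finset.mem_filter.1 hb).1 (Finset.mem_filter.1 hb).2),
    Finset.prod_sub, Finset.sum_mul]
  refine Finset.sum_congr rfl fun T hT => ?_
  have hT := Finset.mem_powerset.1 hT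
  have e3 : lam - ∑ b ∈ T, b =
      ∑ b ∈ pairs B \ T, b + ∑ b ∈ B.toFinset.filter (fun b => ¬ Multiset.card b = 2), b := by
    refine tsub_eq_of_eq_add ?_
    rw [e2, ← Finset.sum_filter_add_sum_filter_not B.toFinset fun b => Multiset.card b = 2]
    have := Finset.sum_sdiff (f := fun b => b) hT
    rw [add_right_comm, this]
    rfl
  rw [raised, e3, hMon_add, hMon_add, hMon_sum, hMon_sum, hMon_sum]
  simp only [pairs]
  ring

theorem Decomp.hCoeff_schurProd {lam : Ptn} (hl : lam.Nodup) {B : Multiset Ptn}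
    (hB : Decomp lam B) (nu : Ptn) :
    hCoeff nu (schurProd B) =
      ∑ T ∈ (pairs B).powerset.filter (fun T => raised lam T = nu), (-1 : ℝ) ^ T.card := by
  rw [hB.schurProd_eq hl, map_sum, Finset.sum_filter]
  refine Finset.sum_congr rfl fun T _ => ?_
  have : ((-1 : SymFun) ^ T.card) * hMon (raised lam T) =
      ((-1 : ℝ) ^ T.card) • hMon (raised lam T) := by
    rw [MvPolynomial.smul_eq_C_mul]; simp
  rw [this, map_smul, hCoeff_hMon, smul_eq_mul, mul_ite, mul_one, mul_zero]

/-- If raising the pairs in `T` stays below raising the single pair `a`, then the pairs in `T`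
lie inside `a`, and the only such `T` that contains `a` is `{a}`. -/
theorem subset_of_raised_le {lam : Ptn} {T : Finset Ptn} (hT : ∑ b ∈ T, b ≤ lam)
    (h2 : ∀ b ∈ T, Multiset.card b = 2) {a : Ptn} (ha : a ≤ lam) (ha2 : Multiset.card a = 2)
    (h : DomLE (raised lam T) (raised lam {a})) :
    (∀ b ∈ T, part a 1 ≤ part b 1 ∧ part b 0 ≤ part a 0) ∧ (a ∈ T → T = {a}) := by
  have key : ∀ t, (T.filter fun b => part b 1 ≤ t ∧ t ≤ part b 0).card ≤
      if part a 1 ≤ t ∧ t ≤ part a 0 then 1 else 0 := by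
    intro t
    have := h.2 t
    rw [tailSum_raised hT h2, tailSum_raised (by simpa using ha) (by simpa using ha2),
      Finset.filter_singleton] at this
    split_ifs at this ⊢ <;> simpa using this
  have hin : ∀ b ∈ T, ∀ t, part b 1 ≤ t → t ≤ part b 0 → part a 1 ≤ t ∧ t ≤ part a 0 := by
    intro b hb t h1 h0
    by_contra hc
    have := key t
    rw [if_neg hc, Nat.le_zero, Finset.card_eq_zero] at this
    exact Finset.notMem_empty b (this ▸ Finset.mem_filter.2 ⟨hb, h1, h0⟩)
  have hab : ∀ b ∈ T, part a 1 ≤ part b 1 ∧ part b 0 ≤ part a 0 := fun b hb =>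
    ⟨(hin b hb _ le_rfl (part_anti b (Nat.zero_le 1))).1,
      (hin b hb _ (part_anti b (Nat.zero_le 1)) le_rfl).2⟩
  refine ⟨hab, fun haT => Finset.eq_singleton_iff_unique_mem.2 ⟨haT, fun b hb => ?_⟩⟩
  have h1 := key (part b 0)
  have hb0 := part_anti b (Nat.zero_le 1)
  rw [if_pos ⟨(hab b hb).1.trans hb0, (hab b hb).2⟩] at h1
  exact Finset.card_le_one.1 h1 b (Finset.mem_filter.2 ⟨hb, hb0, le_rfl⟩) a
    (Finset.mem_filter.2 ⟨haT, (hab b hb).1.trans hb0, (hab b hb).2⟩)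

theorem mem_iff_of_card_two {b : Ptn} (h : Multiset.card b = 2) {x : ℕ+} :
    x ∈ b ↔ (x : ℕ) = part b 0 ∨ (x : ℕ) = part b 1 := by
  obtain ⟨p, q, hb, hp, hq, -⟩ := eq_pair_of_card h
  rw [hp, hq, hb]
  simp

/-- In a nested decomposition, a part strictly between the parts of a pair `a` belongs to a
pair strictly inside `a`. -/
theorem exists_pair_inside {lam : Ptn} (hl : lam.Nodup) {A : Multiset Ptn} (hA : Decomp lam A)
    (hnest : Nested A) {a : Ptn} (ha : a ∈ A) (ha2 : Multiset.card a = 2) {x : ℕ+} (hx : x ∈ lam)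
    (h1 : part a 1 < x) (h0 : (x : ℕ) < part a 0) :
    ∃ c ∈ pairs A, x ∈ c ∧ part a 1 < part c 1 ∧ part c 0 < part a 0 := by
  obtain ⟨c, hc, hxc⟩ := Multiset.mem_join.1 (show x ∈ phi A by rwa [hA.2])
  have hac : a ≠ c := by
    rintro rfl
    rcases (mem_iff_of_card_two ha2).1 hxc with h | h <;> omega
  have n1 := hnest a c (pair_le ha hc hac)
  have n2 := hnest c a (pair_le hc ha hac.symm)
  have hcard := hA.1 c hc
  obtain hc1 | hc2 : Multiset.card c = 1 ∨ Multiset.card c = 2 := by omega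
  · obtain ⟨p, rfl, hp⟩ := eq_singleton_of_card hc1
    rw [Multiset.mem_singleton] at hxc
    subst hxc
    exact absurd (Or.inr (Or.inl ⟨ha2, hc1, by omega, by omega, by omega⟩)) n1
  · refine ⟨c, mem_pairs.2 ⟨hc, hc2⟩, hxc, ?_⟩
    have hne : ∀ i j, i < 2 → j < 2 → part a i ≠ part c j := by
      intro i j hi hj hij
      obtain ⟨y, hy, hy'⟩ := part_mem (lam := a) (i := i) (by omega)
      obtain ⟨z, hz, hz'⟩ := part_mem (lam := c) (i := j) (by omega)
      have : y = z := PNat.coe_injective (by rw [hy', hz', hij])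
      subst this
      exact hac (hA.eq_of_mem hl ha hc hy hz)
    have q1 := hne 0 0 (by omega) (by omega)
    have q2 := hne 0 1 (by omega) (by omega)
    have q3 := hne 1 0 (by omega) (by omega)
    have q4 := hne 1 1 (by omega) (by omega)
    have hlt := hA.part_lt hl hc hc2
    rcases (mem_iff_of_card_two hc2).1 hxc with h | h
    · refine ⟨?_, by omega⟩
      by_contra hcon
      exact n1 (Or.inl ⟨ha2, hc2, by omega, by omega, by omega⟩)
    · refine ⟨by omega, ?_⟩
      by_contra hcon
      exact n2 (Or.inl ⟨hc2, ha2, by omega, by omega, by omega⟩)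

/-- Let `a` be a pair of the nested decomposition `A` such that all shorter pairs of `A` also
belong to `B`. Below the partition where `a` is raised, the coefficients of `s_A` and `s_B` are
sums over the same sets of raised pairs, except for the set `{a}`. -/
theorem hCoeff_eq_of_shorter {lam : Ptn} (hl : lam.Nodup) {A B : Multiset Ptn} (hA : Decomp lam A)
    (hB : Decomp lam B) (hnest : Nested A) {a : Ptn} (ha : a ∈ pairs A)
    (hmin : ∀ c ∈ pairs A, part c 0 - part c 1 < part a 0 - part a 1 → c ∈ B)
    {nu : Ptn} (hnu : DomLE nu (raised lam {a})) :
    hCoeff nu (schurProd B) =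
      hCoeff nu (schurProd A) + if a ∉ B ∧ nu = raised lam {a} then 1 else 0 := by
  obtain ⟨haA, ha2⟩ := mem_pairs.1 ha
  have hal := hA.le haA
  -- a set of pairs of `B` that contributes consists of pairs of `A`
  have c1 : ∀ T, T ⊆ pairs B → raised lam T = nu → T ⊆ pairs A := by
    intro T hT hTnu b hb
    obtain ⟨hbB, hb2⟩ := mem_pairs.1 (hT hb)
    have hin := (subset_of_raised_le (sum_le_of_subset hB hT)
      (fun b hb => (mem_pairs.1 (hT hb)).2) hal ha2 (hTnu ▸ hnu)).1 b hb
    have hlt := hB.part_lt hl hbB hb2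
    by_cases hba : part b 0 = part a 0 ∧ part b 1 = part a 1
    · have : b = a := by
        obtain ⟨p, q, e, hp, hq, -⟩ := eq_pair_of_card ha2
        obtain ⟨p', q', e', hp', hq', -⟩ := eq_pair_of_card hb2
        rw [e, e', PNat.coe_injective (by rw [← hp', ← hp, hba.1] : (p' : ℕ) = p),
          PNat.coe_injective (by rw [← hq', ← hq, hba.2] : (q' : ℕ) = q)]
      rw [this]; exact ha
    · obtain ⟨x, hxb, h1, h0⟩ : ∃ x ∈ b, part a 1 < (x : ℕ) ∧ (x : ℕ) < part a 0 := by
        obtain ⟨y, hy, hy'⟩ := part_mem (lam := b) (i := 0) (by omega)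
        obtain ⟨z, hz, hz'⟩ := part_mem (lam := b) (i := 1) (by omega)
        by_cases h : part b 0 = part a 0
        · exact ⟨z, hz, by omega, by omega⟩
        · exact ⟨y, hy, by omega, by omega⟩
      obtain ⟨c, hcA, hxc, hc1, hc0⟩ := exists_pair_inside hl hA hnest haA ha2
        (Multiset.mem_of_le (hB.le hbB) hxb) h1 h0
      have hclt := hA.part_lt hl (mem_pairs.1 hcA).1 (mem_pairs.1 hcA).2
      rw [hB.eq_of_mem hl hbB (hmin c hcA (by omega)) hxb hxc]
      exact hcA
  -- a set of pairs of `A` that contributes is `{a}` or consists of pairs of `B`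
  have c2 : ∀ T, T ⊆ pairs A → raised lam T = nu → T ⊆ pairs B ∨ T = {a} := by
    intro T hT hTnu
    obtain ⟨hin, hsing⟩ := subset_of_raised_le (sum_le_of_subset hA hT)
      (fun b hb => (mem_pairs.1 (hT hb)).2) hal ha2 (hTnu ▸ hnu)
    by_cases haT : a ∈ T
    · exact Or.inr (hsing haT)
    · refine Or.inl fun b hb => ?_
      obtain ⟨hbA, hb2⟩ := mem_pairs.1 (hT hb)
      refine mem_pairs.2 ⟨hmin b (hT hb) ?_, hb2⟩
      have hlt := hA.part_lt hl hbA hb2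
      have h1 := hin b hb
      by_contra hcon
      have : ∃ x ∈ b, x ∈ a := by
        obtain ⟨y, hy, hy'⟩ := part_mem (lam := b) (i := 0) (by omega)
        exact ⟨y, hy, (mem_iff_of_card_two ha2).2 (by omega)⟩
      obtain ⟨x, hxb, hxa⟩ := this
      exact haT (hA.eq_of_mem hl hbA haA hxb hxa ▸ hb)
  rw [hA.hCoeff_schurProd hl, hB.hCoeff_schurProd hl]
  set FA := (pairs A).powerset.filter (fun T => raised lam T = nu) with hFA
  set FB := (pairs B).powerset.filter (fun T => raised lam T = nu) with hFB
  have hsub : FB ⊆ FA := by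
    intro T hT
    simp only [hFA, hFB, Finset.mem_filter, Finset.mem_powerset] at hT ⊢
    exact ⟨c1 T hT.1 hT.2, hT.2⟩
  rw [← Finset.sum_sdiff hsub]
  have hdiff : FA \ FB = if a ∉ B ∧ nu = raised lam {a} then {{a}} else ∅ := by
    ext T
    simp only [hFA, hFB, Finset.mem_sdiff, Finset.mem_filter, Finset.mem_powerset]
    split_ifs with hif
    · rw [Finset.mem_singleton]
      constructor
      · rintro ⟨⟨h1, h2⟩, h3⟩
        exact (c2 T h1 h2).resolve_left fun h => h3 ⟨h, h2⟩
      · rintro rfl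
        exact ⟨⟨Finset.singleton_subset_iff.2 ha, hif.2.symm⟩,
          fun h => hif.1 (mem_pairs.1 (Finset.singleton_subset_iff.1 h.1)).1⟩
    · simp only [Finset.notMem_empty, iff_false]
      rintro ⟨⟨h1, h2⟩, h3⟩
      refine h3 ⟨?_, h2⟩
      rcases c2 T h1 h2 with h | rfl
      · exact h
      · rw [Finset.singleton_subset_iff, mem_pairs]
        refine ⟨?_, ha2⟩
        by_contra hc
        exact hif ⟨hc, h2.symm⟩
  rw [hdiff]
  split_ifs <;> simp

/-- A nested decomposition has at most one single part, so it is determined by its pairs. -/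
theorem exists_pair_not_mem {lam : Ptn} (hl : lam.Nodup) {A B : Multiset Ptn} (hA : Decomp lam A)
    (hB : Decomp lam B) (hnest : Nested A) (hne : B ≠ A) : ∃ a ∈ pairs A, a ∉ B := by
  by_contra! hcon
  apply hne
  set P := A.filter fun b => Multiset.card b = 2 with hP
  set Q := A.filter fun b => ¬ Multiset.card b = 2 with hQ
  have hPQ : P + Q = A := Multiset.filter_add_not _ A
  have hQ1 : ∀ b ∈ Q, Multiset.card b = 1 := by
    intro b hb
    have h1 := Multiset.mem_filter.1 hb
    have := hA.1 b h1.1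
    omega
  have hPB : P ≤ B := by
    refine (Multiset.le_iff_subset (Multiset.nodup_of_le (Multiset.filter_le _ _)
      (hA.nodup hl))).2 fun b hb => hcon b ?_
    exact mem_pairs.2 (Multiset.mem_filter.1 hb)
  obtain ⟨C, hC⟩ := Multiset.le_iff_exists_add.1 hPB
  have hjoin : C.join = Q.join := by
    have h := hB.2.trans hA.2.symm
    rw [phi, phi, ← hPQ, hC, Multiset.join_add, Multiset.join_add] at h
    exact add_left_cancel h
  have hC1 : ∀ b ∈ C, 1 ≤ Multiset.card b := fun b hb =>
    (hB.1 b (hC ▸ Multiset.mem_add.2 (Or.inr hb))).1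
  rw [hC, ← hPQ]
  congr 1
  rcases Multiset.empty_or_exists_mem Q with hQ0 | ⟨c, hc⟩
  · rw [hQ0] at hjoin ⊢
    by_contra hC0
    obtain ⟨b, hb⟩ := Multiset.exists_mem_of_ne_zero hC0
    obtain ⟨x, hx⟩ := Multiset.card_pos_iff_exists_mem.1 (hC1 b hb)
    have : x ∈ C.join := Multiset.mem_join.2 ⟨b, hb, hx⟩
    rw [hjoin] at this
    simp at this
  · obtain ⟨Q', hQ'⟩ := Multiset.exists_cons_of_mem hc
    have hQ'0 : Q' = 0 := by
      by_contra h0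
      obtain ⟨d, hd⟩ := Multiset.exists_mem_of_ne_zero h0
      obtain ⟨Q'', rfl⟩ := Multiset.exists_cons_of_mem hd
      refine hnest c d ?_ (Or.inr (Or.inr ⟨hQ1 c hc, hQ1 d ?_⟩))
      · rw [← hPQ, hQ']
        exact le_trans (Multiset.cons_le_cons _ (Multiset.singleton_le.2 (Multiset.mem_cons_self _ _)))
          (Multiset.le_add_left _ _)
      · rw [hQ']; simp
    subst hQ'0
    rw [hQ'] at hjoin ⊢
    obtain ⟨p, hp, -⟩ := eq_singleton_of_card (hQ1 c hc)
    have hjp : C.join = {p} := by rw [hjoin, hp]; simp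
    rcases Multiset.empty_or_exists_mem C with hC0 | ⟨b, hb⟩
    · rw [hC0] at hjp; simp at hjp
    · obtain ⟨C', rfl⟩ := Multiset.exists_cons_of_mem hb
      have hcardj := congrArg Multiset.card hjp
      rw [Multiset.join_cons, Multiset.card_add, Multiset.card_singleton] at hcardj
      have hb1 := hC1 b hb
      have hC'0 : C' = 0 := by
        by_contra h0
        obtain ⟨d, hd⟩ := Multiset.exists_mem_of_ne_zero h0
        obtain ⟨C'', rfl⟩ := Multiset.exists_cons_of_mem hd
        have := hC1 d (by simp)
        rw [Multiset.join_cons, Multiset.card_add] at hcardj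
        omega
      subst hC'0
      rw [hp]
      have : b = {p} := by simpa using hjp
      rw [this]

/-! ### Finiteness and weights -/

theorem finite_multiset {α : Type*} {P : Set α} (hP : P.Finite) (n : ℕ) :
    {A : Multiset α | (∀ x ∈ A, x ∈ P) ∧ Multiset.card A ≤ n}.Finite := by
  classical
  refine (Multiset.powerset (n • hP.toFinset.val)).toFinset.finite_toSet.subset ?_
  rintro A ⟨h1, h2⟩
  rw [Finset.mem_coe, Multiset.mem_toFinset, Multiset.mem_powerset, Multiset.le_iff_count]
  intro x
  by_cases hx : x ∈ A
  · rw [Multiset.count_nsmul, Multiset.count_eq_one_of_mem hP.toFinset.nodup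
      (by simpa using h1 x hx), mul_one]
    exact (Multiset.count_le_card x A).trans h2
  · rw [Multiset.count_eq_zero_of_notMem hx]; exact Nat.zero_le _

theorem card_le_size (nu : Ptn) : Multiset.card nu ≤ size nu := by
  have := Multiset.card_nsmul_le_sum (s := nu.map fun k : ℕ+ => (k : ℕ)) (a := 1) (by
    intro x hx
    obtain ⟨k, _, rfl⟩ := Multiset.mem_map.1 hx
    exact k.pos)
  simpa [size] using this

theorem finite_size_le (N : ℕ) : {nu : Ptn | size nu ≤ N}.Finite := by
  have hP : {k : ℕ+ | (k : ℕ) ≤ N}.Finite :=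
    (Set.finite_Iic N).preimage PNat.coe_injective.injOn
  refine (finite_multiset hP N).subset fun nu hnu => ⟨fun k hk => ?_, ?_⟩
  · exact (part_le_size nu hk).trans hnu
  · exact (card_le_size nu).trans hnu

theorem finite_SP (k N : ℕ) : (SP k N).Finite := by
  refine (finite_multiset (finite_size_le N) N).subset fun A hA => ⟨fun b hb => ?_, ?_⟩
  · rw [Set.mem_ofPred_eq, ← hA.2]
    exact Multiset.le_sum_of_mem (Multiset.mem_map_of_mem size hb)
  · have := Multiset.card_nsmul_le_sum (s := A.map size) (a := 1) (by
      intro x hx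
      obtain ⟨b, hb, rfl⟩ := Multiset.mem_map.1 hx
      exact (hA.1 b hb).1.trans (card_le_size b))
    simpa [hA.2] using this

/-- The finite set of partitions of `N`. -/
noncomputable def ptns (N : ℕ) : Finset Ptn :=
  (finite_size_le N).toFinset.filter fun nu => size nu = N

theorem mem_ptns {N : ℕ} {nu : Ptn} : nu ∈ ptns N ↔ size nu = N := by
  rw [ptns, Finset.mem_filter, Set.Finite.mem_toFinset]
  exact ⟨fun h => h.2, fun h => ⟨h.le, h⟩⟩

/-- Finitely many vectors whose first nonzero coordinate is negative have arbitrarily negative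
values under a common integral functional: the weights are chosen from the last coordinate to
the first, each large compared with the later ones. -/
theorem exists_weights {ι : Type*} [LinearOrder ι] (K : Finset ι) (S : Set (ℝ × (ι → ℝ)))
    (hS : S.Finite) : ∃ w : ι → ℤ, ∀ p ∈ S, (∃ k ∈ K, p.2 k < 0 ∧ ∀ j ∈ K, j < k → p.2 j = 0) →
      p.1 + ∑ k ∈ K, w k * p.2 k ≤ 0 := by
  induction K using Finset.induction_on_min with
  | empty => exact ⟨0, by simp⟩
  | insert a s ha ih =>
    obtain ⟨w, hw⟩ := ih
    obtain ⟨b, hb⟩ := 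
      (hS.image fun p => (p.1 + ∑ k ∈ s, (w k : ℝ) * p.2 k) / (-p.2 a)).bddAbove
    obtain ⟨M, hM⟩ := exists_int_gt b
    have has : a ∉ s := fun h => lt_irrefl _ (ha a h)
    refine ⟨Function.update w a M, fun p hp ⟨k, hk, hk1, hk2⟩ => ?_⟩
    have e : ∑ k ∈ s, (Function.update w a M k : ℝ) * p.2 k = ∑ k ∈ s, w k * p.2 k :=
      Finset.sum_congr rfl fun k hk => by rw [Function.update_of_ne (ha k hk).ne']
    rw [Finset.sum_insert has, e, Function.update_self]
    rcases Finset.mem_insert.1 hk with rfl | hks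
    · have h1 : (p.1 + ∑ j ∈ s, w j * p.2 j) / (-p.2 k) ≤ b := hb ⟨p, hp, rfl⟩
      have h2 := (h1.trans_lt hM).le
      rw [div_le_iff₀ (by linarith)] at h2
      linarith
    · rw [hk2 a (Finset.mem_insert_self _ _) (ha k hks), mul_zero, zero_add]
      exact hw p hp ⟨k, hks, hk1, fun j hj => hk2 j (Finset.mem_insert_of_mem hj)⟩

/-! ### Raising a single pair stays below `plus lam` -/

theorem tailSum_plus (lam : Ptn) (hm : 2 ≤ Multiset.card lam) (t : ℕ) :
    tailSum t (plus lam) = tailSum t lam +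
      if part lam (Multiset.card lam - 1) ≤ t ∧ t ≤ part lam 0 then 1 else 0 := by
  obtain ⟨m, hm⟩ := Nat.exists_eq_add_of_le' hm
  rw [tailSum_eq_sum_part t lam le_rfl, plus, tailSum_ofSeq, hm, Finset.sum_range_succ,
    Finset.sum_range_succ', Finset.sum_range_succ, Finset.sum_range_succ']
  have hmid : ∑ k ∈ Finset.range m, (part lam (k + 1) + (if k + 1 = 0 then 1 else 0) -
      (if k + 1 + 1 = m + 2 then 1 else 0) - t) = ∑ k ∈ Finset.range m, (part lam (k + 1) - t) := by
    refine Finset.sum_congr rfl fun k hk => ?_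
    have := Finset.mem_range.1 hk
    rw [if_neg (by omega), if_neg (by omega)]
    rfl
  have h1 := part_anti lam (Nat.zero_le (m + 1))
  obtain ⟨k, -, hk⟩ := part_mem (lam := lam) (i := m + 1) (by omega)
  have := k.pos
  rw [hmid, show m + 2 - 1 = m + 1 by omega]
  simp only [if_true, Nat.add_eq_zero_iff, one_ne_zero, and_false, if_false]
  split_ifs <;> omega

theorem domLE_plus (lam : Ptn) : DomLE lam (plus lam) := by
  suffices h : ∀ t, tailSum t lam ≤ tailSum t (plus lam) ∧ (t = 0 → tailSum t (plus lam) ≤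
      tailSum t lam) by
    refine ⟨?_, fun t => (h t).1⟩
    rw [← tailSum_zero, ← tailSum_zero]
    exact le_antisymm (h 0).1 ((h 0).2 rfl)
  intro t
  by_cases hm : 2 ≤ Multiset.card lam
  · rw [tailSum_plus lam hm]
    obtain ⟨k, -, hk⟩ := part_mem (lam := lam) (i := Multiset.card lam - 1) (by omega)
    have := k.pos
    split_ifs <;> omega
  · have e : tailSum t (plus lam) = tailSum t lam := by
      rw [tailSum_eq_sum_part t lam le_rfl, plus, tailSum_ofSeq]
      refine Finset.sum_congr rfl fun i hi => ?_
      have := Finset.mem_range.1 hi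
      rw [if_pos (by omega), if_pos (by omega), Nat.add_sub_cancel]
    omega

theorem sqSize_le_of_size {nu : Ptn} {N : ℕ} (h : size nu = N) : sqSize nu ≤ N ^ 2 :=
  h ▸ sqSize_le nu

theorem part_mem_bounds {lam : Ptn} {k : ℕ+} (hk : k ∈ lam) :
    part lam (Multiset.card lam - 1) ≤ k ∧ (k : ℕ) ≤ part lam 0 := by
  obtain ⟨i, hi, h⟩ := exists_part_eq hk
  rw [← h]
  exact ⟨part_anti lam (by omega), part_anti lam (Nat.zero_le i)⟩

theorem tailSum_raised_singleton {lam a : Ptn} (ha : a ≤ lam) (h2 : Multiset.card a = 2) (t : ℕ) :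
    tailSum t (raised lam {a}) =
      tailSum t lam + if part a 1 ≤ t ∧ t ≤ part a 0 then 1 else 0 := by
  rw [tailSum_raised (by simpa using ha) (by simpa using h2), Finset.filter_singleton]
  split_ifs <;> simp

theorem domLE_raised_singleton {lam a : Ptn} (ha : a ≤ lam) (h2 : Multiset.card a = 2) :
    DomLE lam (raised lam {a}) := by
  refine ⟨?_, fun t => by rw [tailSum_raised_singleton ha h2]; omega⟩
  have := part_one_pos h2
  rw [← tailSum_zero, ← tailSum_zero, tailSum_raised_singleton ha h2, if_neg (by omega), add_zero]

theorem raised_singleton_le_plus {lam a : Ptn} (ha : a ≤ lam) (h2 : Multiset.card a = 2) :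
    DomLE (raised lam {a}) (plus lam) := by
  refine ⟨(domLE_raised_singleton ha h2).1.symm.trans (domLE_plus lam).1, fun t => ?_⟩
  have hm : 2 ≤ Multiset.card lam := h2 ▸ Multiset.card_le_card ha
  rw [tailSum_raised_singleton ha h2, tailSum_plus lam hm]
  obtain ⟨y, hy, hy'⟩ := part_mem (lam := a) (i := 0) (by omega)
  obtain ⟨z, hz, hz'⟩ := part_mem (lam := a) (i := 1) (by omega)
  have b1 := part_mem_bounds (Multiset.mem_of_le ha hy)
  have b2 := part_mem_bounds (Multiset.mem_of_le ha hz)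
  split_ifs <;> omega

/-! ### The separating functional -/

/-- The regions of partitions to which the weights of the separating functional refer: region
`0` consists of the partitions not above `lam`, and region `l ≥ 1` of those strictly above `lam`
and below the result of raising some pair of `A` whose parts differ by `l`. -/
def Region (lam : Ptn) (A : Multiset Ptn) (l : ℕ) (nu : Ptn) : Prop :=
  if l = 0 then ¬ DomLE lam nu else
    DomLE lam nu ∧ nu ≠ lam ∧
      ∃ a ∈ pairs A, part a 0 - part a 1 = l ∧ DomLE nu (raised lam {a})

open Classical in
/-- Minus the sum of the coefficients of the `h_nu`, where `nu` runs over the partitions in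
region `k.1` with sum of squares `k.2`. -/
noncomputable def levelSum (lam : Ptn) (A : Multiset Ptn) (k : ℕ ×ₗ ℕ) : SymFun →ₗ[ℝ] ℝ :=
  - ∑ nu ∈ (ptns (size lam)).filter fun nu =>
      sqSize nu = (ofLex k).2 ∧ Region lam A (ofLex k).1 nu, hCoeff nu

/-- The sum `levelSum`, corrected by a multiple of the coefficient of `h_lam` so that it
vanishes at `s_A`. -/
noncomputable def levelDiff (lam : Ptn) (A : Multiset Ptn) (k : ℕ ×ₗ ℕ) : SymFun →ₗ[ℝ] ℝ :=
  levelSum lam A k - levelSum lam A k (schurProd A) • hCoeff lam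

/-- The relevant index pairs. -/
def levels (N : ℕ) : Finset (ℕ ×ₗ ℕ) :=
  (Finset.range (N + 1) ×ˢ Finset.range (N ^ 2 + 1)).map toLex.toEmbedding

theorem mem_levels {N l s : ℕ} : toLex (l, s) ∈ levels N ↔ l ≤ N ∧ s ≤ N ^ 2 := by
  simp [levels]

theorem levelSum_eq_zero {lam : Ptn} {A : Multiset Ptn} {l s : ℕ} {x : SymFun}
    (h : ∀ nu, sqSize nu = s → Region lam A l nu → hCoeff nu x = 0) :
    levelSum lam A (toLex (l, s)) x = 0 := by
  classical
  rw [levelSum, LinearMap.neg_apply, LinearMap.sum_apply, neg_eq_zero]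
  refine Finset.sum_eq_zero fun nu hnu => ?_
  obtain ⟨-, h1, h2⟩ := Finset.mem_filter.1 hnu
  exact h nu h1 h2

/-- Region `l` is a lower set up to the partitions in region `0`. -/
theorem Region.of_le {lam : Ptn} {A : Multiset Ptn} {l : ℕ} {mu nu : Ptn}
    (h : Region lam A l nu) (hmu : DomLE mu nu) (hne : mu ≠ lam) :
    Region lam A l mu ∨ Region lam A 0 mu := by
  by_cases h0 : DomLE lam mu
  · left
    unfold Region at h ⊢
    split_ifs at h ⊢
    · exact absurd (h0.trans hmu) h
    · obtain ⟨-, -, a, ha, hal, hle⟩ := h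
      exact ⟨h0, hne, a, ha, hal, hmu.trans hle⟩
  · right
    rwa [Region, if_pos rfl]

theorem Region.le_size {lam : Ptn} {A : Multiset Ptn} (hA : Decomp lam A) {l : ℕ} {nu : Ptn}
    (h : Region lam A l nu) : l ≤ size lam := by
  unfold Region at h
  split_ifs at h with h0
  · omega
  · obtain ⟨-, -, a, ha, hal, -⟩ := h
    obtain ⟨haA, ha2⟩ := mem_pairs.1 ha
    obtain ⟨y, hy, hy'⟩ := part_mem (lam := a) (i := 0) (by omega)
    have := part_le_size lam (Multiset.mem_of_le (hA.le haA) hy)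
    omega

theorem size_phi (B : Multiset Ptn) : size (phi B) = (B.map size).sum := by
  induction B using Multiset.induction_on with
  | empty => simp [phi, size]
  | cons b B ih =>
    have : phi (b ::ₘ B) = b + phi B := by simp [phi]
    rw [this, size_add, ih, Multiset.map_cons, Multiset.sum_cons]

theorem decomp_of_mem_SP {B : Multiset Ptn} {N : ℕ} (hB : B ∈ SP 2 N) : Decomp (phi B) B :=
  ⟨hB.1, rfl⟩

/-- If `phi B ≠ lam`, the values of `levelDiff` at `s_B` are those of the leading coefficient:
the first nonzero one belongs to the first region that contains `phi B`. -/
theorem levelDiff_of_phi_ne {lam : Ptn} {A B : Multiset Ptn} (hA : Decomp lam A)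
    (hsize : size (phi B) = size lam) (hne : phi B ≠ lam) :
    (∃ k ∈ levels (size lam), levelDiff lam A k (schurProd B) < 0 ∧
      ∀ j ∈ levels (size lam), j < k → levelDiff lam A j (schurProd B) = 0) ∨
    (hCoeff lam (schurProd B) = 0 ∧
      ∀ k ∈ levels (size lam), levelDiff lam A k (schurProd B) = 0) := by
  classical
  have hA0 : ∀ s, levelSum lam A (toLex (0, s)) (schurProd A) = 0 := by
    refine fun s => levelSum_eq_zero fun nu _ hnu => ?_
    rw [Region, if_pos rfl] at hnu
    by_contra hc
    rcases hCoeff_schurProd_ne_zero hc with h | h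
    · rw [h, hA.2] at hnu; exact hnu (DomLE.refl _)
    · rw [hA.2] at h; exact hnu h.1
  have hlam : ¬ Region lam A 0 (phi B) → hCoeff lam (schurProd B) = 0 := by
    intro h
    rw [Region, if_pos rfl, not_not] at h
    by_contra hc
    rcases hCoeff_schurProd_ne_zero hc with h' | h'
    · exact hne h'.symm
    · exact absurd h.sqSize_le (not_le.2 h'.2)
  -- the correction term does not matter up to the first region containing `phi B`
  have hcorr : ∀ l s, (∀ l' < l, ¬ Region lam A l' (phi B)) →
      levelDiff lam A (toLex (l, s)) (schurProd B) =
        levelSum lam A (toLex (l, s)) (schurProd B) := by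
    intro l s hmin
    have : levelSum lam A (toLex (l, s)) (schurProd A) * hCoeff lam (schurProd B) = 0 := by
      rcases Nat.eq_zero_or_pos l with rfl | hl
      · rw [hA0, zero_mul]
      · rw [hlam (hmin 0 hl), mul_zero]
    rw [levelDiff, LinearMap.sub_apply, LinearMap.smul_apply, smul_eq_mul, this, sub_zero]
  have hzero : ∀ l s, (∀ l' ≤ l, ¬ Region lam A l' (phi B)) →
      levelDiff lam A (toLex (l, s)) (schurProd B) = 0 := by
    intro l s hmin
    rw [hcorr l s fun l' hl' => hmin l' hl'.le]
    refine levelSum_eq_zero fun nu _ hnu => ?_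
    by_contra hc
    have hle : DomLE (phi B) nu := by
      rcases hCoeff_schurProd_ne_zero hc with rfl | h
      · exact DomLE.refl _
      · exact h.1
    rcases hnu.of_le hle hne with h | h
    · exact hmin l le_rfl h
    · exact hmin 0 (Nat.zero_le _) h
  by_cases hex : ∃ l, Region lam A l (phi B)
  · left
    set l := Nat.find hex with hl
    have hreg : Region lam A l (phi B) := Nat.find_spec hex
    have hmin : ∀ l' < l, ¬ Region lam A l' (phi B) := fun l' h => Nat.find_min hex h
    refine ⟨toLex (l, sqSize (phi B)), mem_levels.2 ⟨hreg.le_size hA, sqSize_le_of_size hsize⟩,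
      ?_, ?_⟩
    · rw [hcorr l _ hmin, levelSum, LinearMap.neg_apply, LinearMap.sum_apply,
        Finset.sum_eq_single (phi B)]
      · rw [hCoeff_schurProd_self]; norm_num
      · intro nu hnu hnu'
        obtain ⟨-, h1, -⟩ := Finset.mem_filter.1 hnu
        by_contra hc
        rcases hCoeff_schurProd_ne_zero hc with h | h
        · exact hnu' h
        · exact absurd h1 h.2.ne'
      · exact fun h => absurd (Finset.mem_filter.2 ⟨mem_ptns.2 hsize, rfl, hreg⟩) h
    · intro j _ hj
      obtain ⟨⟨l', s⟩, rfl⟩ := toLex.surjective j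
      rcases Prod.Lex.toLex_lt_toLex.1 hj with h | ⟨h, h'⟩
      · exact hzero l' s fun l'' h'' => hmin l'' (lt_of_le_of_lt h'' h)
      · simp only at h h'
        subst h
        rw [hcorr _ s hmin]
        refine levelSum_eq_zero fun nu hs _ => ?_
        by_contra hc
        rcases hCoeff_schurProd_ne_zero hc with h | h
        · rw [h] at hs; omega
        · have := h.2; omega
  · right
    push Not at hex
    refine ⟨hlam (hex 0), fun k _ => ?_⟩
    obtain ⟨⟨l, s⟩, rfl⟩ := toLex.surjective k
    exact hzero l s fun l' _ => hex l'

/-- If `phi B = lam` and `B ≠ A`, the first nonzero value of `levelDiff` at `s_B` comes from a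
shortest pair of `A` that does not belong to `B`. -/
theorem levelDiff_of_phi_eq {lam : Ptn} (hl : lam.Nodup) {A B : Multiset Ptn} (hA : Decomp lam A)
    (hnest : Nested A) (hB : Decomp lam B) (hne : B ≠ A) :
    ∃ k ∈ levels (size lam), levelDiff lam A k (schurProd B) < 0 ∧
      ∀ j ∈ levels (size lam), j < k → levelDiff lam A j (schurProd B) = 0 := by
  classical
  -- `a` is a shortest pair of `A` that does not belong to `B`
  obtain ⟨a₀, ha₀, ha₀B⟩ := exists_pair_not_mem hl hA hB hnest hne
  obtain ⟨a, ha, hamin⟩ := Finset.exists_min_image ((pairs A).filter fun a => a ∉ B)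
    (fun a => part a 0 - part a 1) ⟨a₀, Finset.mem_filter.2 ⟨ha₀, ha₀B⟩⟩
  obtain ⟨haP, haB⟩ := Finset.mem_filter.1 ha
  obtain ⟨haA, ha2⟩ := mem_pairs.1 haP
  have hal := hA.le haA
  have hlt := hA.part_lt hl haA ha2
  have hmin : ∀ c ∈ pairs A, part c 0 - part c 1 < part a 0 - part a 1 → c ∈ B := by
    intro c hc hlt
    by_contra hcB
    exact absurd (hamin c (Finset.mem_filter.2 ⟨hc, hcB⟩)) (not_le.2 hlt)
  have hone : hCoeff lam (schurProd B) = 1 := by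
    have := hCoeff_schurProd_self B
    rwa [hB.2] at this
  have hdiff : ∀ k, levelDiff lam A k (schurProd B) =
      - ∑ nu ∈ (ptns (size lam)).filter fun nu =>
        sqSize nu = (ofLex k).2 ∧ Region lam A (ofLex k).1 nu,
          (hCoeff nu (schurProd B) - hCoeff nu (schurProd A)) := by
    intro k
    rw [levelDiff, LinearMap.sub_apply, LinearMap.smul_apply, hone, smul_eq_mul, mul_one, levelSum,
      LinearMap.neg_apply, LinearMap.neg_apply, LinearMap.sum_apply, LinearMap.sum_apply,
      Finset.sum_sub_distrib]
    ring
  -- the difference of coefficients in the regions up to the length of `a`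
  have hcoef : ∀ l nu, l ≤ part a 0 - part a 1 → Region lam A l nu →
      hCoeff nu (schurProd B) = hCoeff nu (schurProd A) ∨
      (l = part a 0 - part a 1 ∧ sqSize nu = sqSize (raised lam {a}) ∧
        hCoeff nu (schurProd B) = hCoeff nu (schurProd A) + 1) := by
    intro l nu hla hnu
    rcases Nat.eq_zero_or_pos l with rfl | hpos
    · left
      rw [Region, if_pos rfl] at hnu
      have h0 : ∀ C, Decomp lam C → hCoeff nu (schurProd C) = 0 := by
        intro C hC
        by_contra hc
        rcases hCoeff_schurProd_ne_zero hc with h | h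
        · rw [h, hC.2] at hnu; exact hnu (DomLE.refl _)
        · rw [hC.2] at h; exact hnu h.1
      rw [h0 A hA, h0 B hB]
    · rw [Region, if_neg hpos.ne'] at hnu
      obtain ⟨-, -, c, hc, hcl, hcle⟩ := hnu
      have := hCoeff_eq_of_shorter hl hA hB hnest hc (fun d hd hdl => hmin d hd (by omega)) hcle
      split_ifs at this with hif
      · right
        have hge := hamin c (Finset.mem_filter.2 ⟨hc, hif.1⟩)
        refine ⟨by omega, ?_, this⟩
        rw [hif.2, sqSize_raised_singleton (hA.le (mem_pairs.1 hc).1) (mem_pairs.1 hc).2,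
          sqSize_raised_singleton hal ha2, show part c 0 - part c 1 = part a 0 - part a 1 by omega]
      · left
        rw [this, add_zero]
  have hraised := domLE_raised_singleton hal ha2
  have hreg : Region lam A (part a 0 - part a 1) (raised lam {a}) := by
    rw [Region, if_neg (by omega)]
    refine ⟨hraised, fun h => ?_, a, haP, rfl, DomLE.refl _⟩
    have := sqSize_raised_singleton hal ha2
    rw [h] at this
    omega
  have hself : hCoeff (raised lam {a}) (schurProd B) =
      hCoeff (raised lam {a}) (schurProd A) + 1 := by
    rw [hCoeff_eq_of_shorter hl hA hB hnest haP hmin (DomLE.refl _), if_pos ⟨haB, rfl⟩]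
  refine ⟨toLex (part a 0 - part a 1, sqSize (raised lam {a})),
    mem_levels.2 ⟨hreg.le_size hA, sqSize_le_of_size hraised.1.symm⟩, ?_, ?_⟩
  · rw [hdiff, neg_lt_zero]
    refine Finset.sum_pos' (fun nu hnu => ?_) ⟨raised lam {a}, ?_, ?_⟩
    · obtain ⟨-, -, h⟩ := Finset.mem_filter.1 hnu
      rcases hcoef _ nu le_rfl h with h | ⟨-, -, h⟩ <;> rw [h] <;> simp
    · exact Finset.mem_filter.2 ⟨mem_ptns.2 hraised.1.symm, rfl, hreg⟩
    · rw [hself]; simp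
  · intro j _ hj
    obtain ⟨⟨l, s⟩, rfl⟩ := toLex.surjective j
    rw [hdiff, neg_eq_zero]
    refine Finset.sum_eq_zero fun nu hnu => ?_
    obtain ⟨-, hs, hr⟩ := Finset.mem_filter.1 hnu
    simp only [ofLex_toLex] at hs hr
    rcases Prod.Lex.toLex_lt_toLex.1 hj with h | ⟨h, h'⟩
    · simp only at h
      rcases hcoef l nu h.le hr with h1 | ⟨h1, -, -⟩
      · rw [h1, sub_self]
      · omega
    · simp only at h h'
      rcases hcoef l nu h.le hr with h1 | ⟨-, h1, -⟩
      · rw [h1, sub_self]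
      · omega

/-- The functional `F` is defined on all symmetric functions and is nonpositive at every generator
other than `s_A`. Only its values at the `h_nu` with `nu` above `lam` are confined to the
interval. -/
theorem exists_functional {lam : Ptn} (hl : lam.Nodup) {A : Multiset Ptn} (hA : Decomp lam A)
    (hnest : Nested A) :
    ∃ F : SymFun →ₗ[ℝ] ℝ, (∀ x ∈ intPoly, ∃ z : ℤ, F x = z) ∧
      (∀ nu, DomLE lam nu → F (hMon nu) ≠ 0 → DomLE nu (plus lam)) ∧
      F (schurProd A) = 1 ∧ ∀ B ∈ SP 2 (size lam), B ≠ A → F (schurProd B) ≤ 0 := by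
  classical
  obtain ⟨w, hw⟩ := exists_weights (levels (size lam))
    ((fun B => (hCoeff lam (schurProd B), fun k => levelDiff lam A k (schurProd B))) ''
      SP 2 (size lam)) ((finite_SP 2 (size lam)).image _)
  have happ : ∀ x, (hCoeff lam + ∑ k ∈ levels (size lam), (w k : ℝ) • levelDiff lam A k) x =
      hCoeff lam x + ∑ k ∈ levels (size lam), w k * levelDiff lam A k x := by
    intro x
    simp [LinearMap.sum_apply]
  have hAlam : hCoeff lam (schurProd A) = 1 := by
    have := hCoeff_schurProd_self A
    rwa [hA.2] at this
  refine ⟨hCoeff lam + ∑ k ∈ levels (size lam), (w k : ℝ) • levelDiff lam A k, ?_, ?_, ?_, ?_⟩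
  · have hsum : ∀ k, ∀ x ∈ intPoly, levelSum lam A k x ∈ (Int.castRingHom ℝ).range := by
      intro k x hx
      rw [levelSum, LinearMap.neg_apply, LinearMap.sum_apply]
      refine Subring.neg_mem _ (Subring.sum_mem _ fun nu _ => ?_)
      obtain ⟨z, hz⟩ := hCoeff_intPoly hx nu
      exact ⟨z, hz.symm⟩
    have hco : ∀ x ∈ intPoly, hCoeff lam x ∈ (Int.castRingHom ℝ).range := by
      intro x hx
      obtain ⟨z, hz⟩ := hCoeff_intPoly hx lam
      exact ⟨z, hz.symm⟩
    intro x hx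
    suffices h : hCoeff lam x + ∑ k ∈ levels (size lam), w k * levelDiff lam A k x ∈
        (Int.castRingHom ℝ).range by
      obtain ⟨z, hz⟩ := h
      exact ⟨z, (happ x).trans hz.symm⟩
    refine Subring.add_mem _ (hco x hx) (Subring.sum_mem _ fun k _ =>
      Subring.mul_mem _ ⟨w k, rfl⟩ (Subring.sub_mem _ (hsum k x hx) (Subring.mul_mem _
        (hsum k _ (schurProd_mem_intPoly A)) (hco x hx))))
  · intro nu hnu hF
    by_cases hnl : nu = lam
    · rw [hnl]; exact domLE_plus lam
    by_contra hc
    apply hF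
    have h0 : hCoeff lam (hMon nu) = 0 := by rw [hCoeff_hMon, if_neg hnl]
    rw [happ, h0, zero_add]
    refine Finset.sum_eq_zero fun k _ => ?_
    obtain ⟨⟨l, s⟩, rfl⟩ := toLex.surjective k
    rw [levelDiff, LinearMap.sub_apply, LinearMap.smul_apply, h0, smul_zero, sub_zero,
      levelSum_eq_zero, mul_zero]
    intro mu _ hmu
    rw [hCoeff_hMon, if_neg]
    rintro rfl
    unfold Region at hmu
    split_ifs at hmu
    · exact hmu hnu
    · obtain ⟨-, -, a, ha, -, hle⟩ := hmu
      obtain ⟨haA, ha2⟩ := mem_pairs.1 ha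
      exact hc (hle.trans (raised_singleton_le_plus (hA.le haA) ha2))
  · rw [happ, hAlam, add_eq_left]
    refine Finset.sum_eq_zero fun k _ => ?_
    rw [levelDiff, LinearMap.sub_apply, LinearMap.smul_apply, hAlam, smul_eq_mul, mul_one,
      sub_self, mul_zero]
  · intro B hB hBA
    rw [happ]
    have hwB := hw _ ⟨B, hB, rfl⟩
    have hsize : size (phi B) = size lam := by rw [size_phi, hB.2]
    by_cases hphi : phi B = lam
    · exact hwB (levelDiff_of_phi_eq hl hA hnest (hphi ▸ decomp_of_mem_SP hB) hBA)
    · rcases levelDiff_of_phi_ne hA hsize hphi with h | ⟨h0, h⟩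
      · exact hwB h
      · rw [h0, zero_add, Finset.sum_eq_zero fun k hk => by rw [h k hk, mul_zero]]

/-! ### The separating symmetric function -/

theorem schurBasis_apply (mu : Ptn) : schurBasis mu = schur mu := by simp [schurBasis]

/-- The symmetric function that represents `F` on the span of finitely many Schur functions. -/
noncomputable def represent (F : SymFun →ₗ[ℝ] ℝ) (I : Finset Ptn) : SymFun :=
  ∑ mu ∈ I, F (schur mu) • schur mu

theorem hallInner_represent (F : SymFun →ₗ[ℝ] ℝ) (I : Finset Ptn) (x : SymFun) :
    hallInner (represent F I) x = ∑ mu ∈ I, F (schur mu) * schurBasis.repr x mu := by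
  have h : ∀ y, hallInner y x =
      Finsupp.linearCombination ℝ (fun mu => schurBasis.repr x mu) (schurBasis.repr y) :=
    fun y => rfl
  rw [h, represent, map_sum, map_sum]
  refine Finset.sum_congr rfl fun mu _ => ?_
  rw [map_smul, ← schurBasis_apply, schurBasis.repr_self, map_smul,
    Finsupp.linearCombination_single, one_smul, smul_eq_mul]

theorem hallInner_represent_schur (F : SymFun →ₗ[ℝ] ℝ) (I : Finset Ptn) (mu : Ptn) :
    hallInner (represent F I) (schur mu) = if mu ∈ I then F (schur mu) else 0 := by
  classical
  rw [hallInner_represent, ← schurBasis_apply mu, schurBasis.repr_self]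
  simp [Finsupp.single_apply, schurBasis_apply]

theorem hallInner_represent_of_mem (F : SymFun →ₗ[ℝ] ℝ) {I : Finset Ptn} {lam : Ptn}
    (hI : ∀ mu, DomLE lam mu → mu ∈ I) {x : SymFun} (hx : x ∈ schurAbove lam) :
    hallInner (represent F I) x = F x := by
  induction hx using Submodule.span_induction with
  | mem x hx =>
    obtain ⟨mu, hmu, rfl⟩ := hx
    rw [hallInner_represent_schur, if_pos (hI mu hmu)]
  | zero => simp [hallInner_represent]
  | add x y _ _ hx hy =>
    rw [map_add, ← hx, ← hy]
    simp [hallInner_represent, mul_add, Finset.sum_add_distrib]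
  | smul c x _ hx =>
    rw [map_smul, ← hx]
    simp [hallInner_represent, Finset.mul_sum, mul_left_comm]

theorem exists_hMon_of_schur_ne_zero {F : SymFun →ₗ[ℝ] ℝ} {mu : Ptn} (h : F (schur mu) ≠ 0) :
    ∃ nu, DomLE mu nu ∧ F (hMon nu) ≠ 0 := by
  by_contra! hc
  apply h
  have e : schur mu = hMon mu + (schur mu - hMon mu) := by ring
  rw [e, map_add, hc mu (DomLE.refl _), zero_add]
  refine (Submodule.span_le.2 ?_ : upper mu ≤ LinearMap.ker F) (schur_sub_hMon_mem mu)
  rintro _ ⟨nu, hnu, rfl⟩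
  exact hc nu hnu.1

end SchurCone

open SchurCone
theorem mainTheorem1 (lam : Ptn) (hdistinct : Multiset.Nodup lam)
    (A : Multiset Ptn) (hA : A ∈ SSP lam) :
    (∃ f : SymFun, SchurIntegral f ∧ SeparatesOn f A lam (plus lam)) ∧
      IsExtremeInCone 2 (size lam) A := by
  classical
  obtain ⟨hSP, hnest, hphi⟩ := hA
  obtain ⟨F, hint, hsupp, hFA, hFB⟩ := exists_functional hdistinct
    (⟨hSP.1, hphi⟩ : Decomp lam A) hnest
  refine ⟨?_, hSP, fun hmem => ?_⟩
  -- the separating function; `I` is the set of all partitions above `lam`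
  · set I := (ptns (size lam)).filter fun mu => DomLE lam mu with hI
    have hmemI : ∀ mu, mu ∈ I ↔ DomLE lam mu := fun mu => by
      rw [hI, Finset.mem_filter, mem_ptns]
      exact ⟨fun h => h.2, fun h => ⟨h.1.symm, h⟩⟩
    have hrep : ∀ B, DomLE lam (phi B) →
        hallInner (represent F I) (schurProd B) = F (schurProd B) := fun B hB =>
      hallInner_represent_of_mem F (fun mu => (hmemI mu).2) (schurProd_mem_schurAbove hB)
    refine ⟨represent F I, fun mu => ?_, fun mu hmu => ?_, ?_, fun B hB hBI hBA => ?_⟩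
    · rw [hallInner_represent_schur]
      split_ifs
      · exact hint _ (schur_mem_intPoly mu)
      · exact ⟨0, by simp⟩
    · rw [hallInner_represent_schur]
      split_ifs with h
      · by_contra hc
        obtain ⟨nu, hnu, hF⟩ := exists_hMon_of_schur_ne_zero hc
        have h := (hmemI mu).1 h
        exact hmu ⟨(dominates_iff _ _).2 h,
          (dominates_iff _ _).2 (hnu.trans (hsupp nu (h.trans hnu) hF))⟩
      · rfl
    · rw [hrep A (hphi ▸ DomLE.refl _), hFA]
      exact one_pos
    · rw [hrep B ((dominates_iff _ _).1 hBI.1)]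
      exact hFB B hB hBA
  -- extremality: `F` is nonpositive on the cone of the other generators
  · have hle : ∀ x ∈ PointedCone.hull ℝ (schurProd '' (SP 2 (size lam) \ {A})), F x ≤ 0 := by
      intro x hx
      induction hx using Submodule.span_induction with
      | mem x hx =>
        obtain ⟨B, ⟨hB, hBA⟩, rfl⟩ := hx
        exact hFB B hB hBA
      | zero => simp
      | add x y _ _ hx hy => rw [map_add]; exact add_nonpos hx hy
      | smul c x _ hx =>
        have : F (c • x) = (c : ℝ) * F x := F.map_smul (c : ℝ) x
        rw [this]
        exact mul_nonpos_of_nonneg_of_nonpos c.2 hx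
    have := hle _ hmem
    rw [hFA] at this
    exact absurd this (by norm_num)
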